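/- There are absolute constants $c,c_0,c_1>0$ such that the following holds. Let $\sigma(x)=(\max\{x_1,0\},\dots,\max\{x_d,0\})$ be the ReLU on $\mathbb{R}^d$, let $x_0=0$ and $x_{i+1}=\sigma(\Theta^\star x_i)+\varepsilon_i$ for $0\le i\le n$, where $\varepsilon_0,\dots,\varepsilon_n$ are independent $\mathcal{N}(0,I)$ vectors; they are subgaussian with variance proxy $\tau^2$, i.e. $\sup_{\|\theta\|=1}\sup_{p\ge1}p^{-1/2}(\mathbb{E}|\langle\varepsilon_i,\theta\rangle|^p)^{1/p}=\tau$. Suppose that $(\Theta^\star)^{\top}K\Theta^\star\preceq\rho K$ for a diagonal matrix $K\succeq I$ and some $0\le\rho<1$, and that $\|\Theta^\star\|_F\le W$. Put $R=\mathrm{tr}(K)/(1-\rho)$ and $B=4R$. Starting from $\widehat\Theta^{(1)}=0$, let $$\widehat\Theta^{(t+1)}=\mathrm{Proj}_{\{\|\Theta\|_F\le W\}}\Big(\widehat\Theta^{(t)}-\eta\cdot\frac1n\sum_{i=1}^n\big(\sigma(\widehat\Theta^{(t)}x_i)-x_{i+1}\big)x_i^{\top}\Big),\qquad \eta=(16R)^{-2}e^{-4\rho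 R},$$ where $\mathrm{Proj}$ is the Euclidean (Frobenius) projection. Let $\delta>0$. If $$n\ge c\,\frac{\tau^4d^3}{1-\rho}\log(R/\delta+1)\qquad\text{and}\qquad m\ge \max\{1,\;c_0B^2e^{8\rho R}\log n\},$$ then with probability at least $1-\delta$ the last iterate $\widehat\Theta=\widehat\Theta^{(m)}$ satisfies $$\|\widehat\Theta-\Theta^\star\|_F^2\le C_1\,\frac{d^2}{n}\,R^2\log^2\!\Big(\frac{2Rn}{\delta}+1\Big),\qquad C_1=\frac{c_1\,\tau\max\{W^2,1\}}{(1-\rho)^2}\,e^{8\rho R}.$$ -/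

import Mathlib

open MeasureTheory ProbabilityTheory

-- Throughout, the norm of a matrix is its Frobenius norm.
attribute [local instance] Matrix.frobeniusNormedAddCommGroup

namespace GLDS

/-- The state space `ℝ^d` with its Euclidean norm. -/
abbrev State (d : ℕ) : Type := EuclideanSpace ℝ (Fin d)

/-- The real `d × d` matrices. -/
abbrev Mat (d : ℕ) : Type := Matrix (Fin d) (Fin d) ℝ

/-- The ReLU link, applied coordinatewise. -/
noncomputable def relu {d : ℕ} (x : State d) : State d :=
  WithLp.toLp 2 (fun j => max (x j) 0)

/-- The generalized linear map `x ↦ σ (Θ x)`. -/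
noncomputable def glm {d : ℕ} (σ : State d → State d) (Θ : Mat d) (x : State d) : State d :=
  σ (Matrix.toEuclideanLin Θ x)

/-- The trajectory of the noisy system `x_{i+1} = f (x_i) + ε_i` started from `x_0 = 0`. -/
noncomputable def trajectory {d : ℕ} (f : State d → State d) (ε : ℕ → State d) : ℕ → State d
  | 0 => 0
  | i + 1 => f (trajectory f ε i) + ε i

/-- A centered random vector `v` is subgaussian with variance proxy `τ²`:
`sup_{‖θ‖ = 1} sup_{p ≥ 1} p^{-1/2} (E |⟨v, θ⟩|^p)^{1/p} = τ` and `E v = 0`. -/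
def IsSubgaussian {d : ℕ} {Ω : Type*} [MeasurableSpace Ω] (μ : Measure Ω)
    (v : Ω → State d) (τ : ℝ) : Prop :=
  0 ≤ τ ∧ Integrable v μ ∧ ∫ ω, v ω ∂μ = 0 ∧
    (⨆ (θ : State d) (_ : ‖θ‖ = 1) (p : ℝ) (_ : 1 ≤ p),
      ENNReal.ofReal (p ^ (-(1 / 2) : ℝ)) *
        eLpNorm (fun ω => inner ℝ (v ω) θ) (ENNReal.ofReal p) μ) = ENNReal.ofReal τ

/-- The noise `ε_0, …, ε_n`: independent, isotropic (centered with identity covariance) and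
subgaussian with variance proxy `τ²`. -/
structure IsIsotropicNoise {d : ℕ} {Ω : Type*} [MeasurableSpace Ω] (μ : Measure Ω)
    (n : ℕ) (ε : ℕ → Ω → State d) (τ : ℝ) : Prop where
  measurable : ∀ i ≤ n, Measurable (ε i)
  indep : iIndepFun (fun i : Fin (n + 1) => ε i) μ
  isotropic : ∀ i ≤ n, ∀ j k : Fin d,
    ∫ ω, ε i ω j * ε i ω k ∂μ = (1 : Mat d) j k
  subgaussian : ∀ i ≤ n, IsSubgaussian μ (ε i) τ

/-- The constrained Lyapunov condition `Θᵀ K Θ ≼ ρ K` with `K` diagonal and positive definite,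
normalized so that `K ≽ I`, and with `0 ≤ ρ < 1`. -/
structure IsLyapunovStable {d : ℕ} (Θ K : Mat d) (ρ : ℝ) : Prop where
  diag : K.IsDiag
  posDef : K.PosDef
  one_le : (K - 1).PosSemidef
  rho_nonneg : 0 ≤ ρ
  rho_lt_one : ρ < 1
  lyapunov : (ρ • K - Θ.transpose * K * Θ).PosSemidef

/-- The effective radius `R_{K,ρ} = tr K / (1 - ρ)`. -/
noncomputable def effRadius {d : ℕ} (K : Mat d) (ρ : ℝ) : ℝ := K.trace / (1 - ρ)

/-- `P` is a Euclidean (Frobenius) projection of `A` onto `S`. -/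
def IsProj {d : ℕ} (S : Set (Mat d)) (A P : Mat d) : Prop :=
  P ∈ S ∧ ∀ Q ∈ S, ‖A - P‖ ≤ ‖A - Q‖

/-- The Euclidean (Frobenius) projection onto `S`; it exists and is unique when `S` is
nonempty, closed and convex. -/
noncomputable def proj {d : ℕ} (S : Set (Mat d)) (A : Mat d) : Mat d :=
  Classical.epsilon (IsProj S A)

/-- The pseudogradient
`G(Θ, X) = (1/n) ∑_{i=1}^n (σ (Θ x_i) - x_{i+1}) x_iᵀ`. -/
noncomputable def pseudograd {d : ℕ} (σ : State d → State d) (n : ℕ) (x : ℕ → State d)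
    (Θ : Mat d) : Mat d :=
  (1 / (n : ℝ)) • ∑ i ∈ Finset.Icc 1 n,
    Matrix.vecMulVec (glm σ Θ (x i) - x (i + 1)).ofLp (x i).ofLp

/-- The iterates of projected pseudogradient descent over the Frobenius ball of radius `W`,
with learning rates `η 1, η 2, …`: the value at `t` is the iterate `Θ^(t+1)`, so that
`Θ^(1) = 0` and `Θ^(t+1) = Proj (Θ^(t) - η_t G(Θ^(t), X))` for `t ≥ 1`. -/
noncomputable def iterate {d : ℕ} (σ : State d → State d) (W : ℝ) (η : ℕ → ℝ) (n : ℕ)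
    (x : ℕ → State d) : ℕ → Mat d
  | 0 => 0
  | t + 1 => proj {Θ : Mat d | ‖Θ‖ ≤ W}
      (iterate σ W η n x t - η (t + 1) • pseudograd σ n x (iterate σ W η n x t))

/-- The output `Θ^(m)` (last iterate) of the algorithm, for `m ≥ 1`. -/
noncomputable def lastIterate {d : ℕ} (σ : State d → State d) (W : ℝ) (η : ℕ → ℝ) (n : ℕ)
    (x : ℕ → State d) (m : ℕ) : Mat d :=
  iterate σ W η n x (m - 1)

end GLDS

/-! The pseudogradient is a signal part minus a noise part (`pseudograd_eq`). Since ReLU is monotone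
and 1-Lipschitz, the signal part has inner product with Θ - Θ⋆ at least the empirical prediction
error (`predError_le_frobInner`). If that error dominates α‖Θ - Θ⋆‖², every projected step contracts
towards Θ⋆ up to the noise part (`iterate_error_le`). It remains to control three quantities along
one trajectory, each through an exponential supermartingale and Markov's inequality
(`measure_exp_sum_ge_le`).

Energy: K is diagonal and ReLU shrinks coordinates, so the energy xᵀKx contracts by ρ before noise
is added, and its time average is O(R) (`energy_deviation`).

Noise: the entries of the noise part are martingale sums, controlled by the energy
(`noise_deviation`).

Curvature: a row of Θ⋆ might keep its ReLU switched off and so reveal nothing. Given the past,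
however, the state is Gaussian with mean m = σ(Θ⋆x). A function with values in [0,1] and mean k
under the centered Gaussian keeps mean at least k²exp(-‖m‖²) after the shift
(`sq_integral_le_integral_shift`), and the centered Gaussian is symmetric, so increments are visible
on average. Uniformity over all parameters needs a net for the direction of θ - w only: for a fixed
direction, two bounded functions minorize the squared increments at all scales
(`exists_relu_minorants`). Jensen's inequality and the energy bound turn the factors exp(-‖m‖²) into
exp(-3ρR) on average.

All this is needed only for n above a multiple of exp(8ρR)d²R²L²/(1-ρ)², with L the logarithm in the
bound. For smaller n the claimed bound exceeds the squared diameter of the Frobenius ball. -/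

namespace GLDS

/-! ### Gaussian exponential moments and shifts -/

section Gaussian

open scoped NNReal

lemma lintegral_pi_prod_eq_prod {ι : Type*} [Fintype ι] (ν : ι → Measure ℝ)
    [∀ i, IsProbabilityMeasure (ν i)] (f : ι → ℝ → ENNReal) (hf : ∀ i, Measurable (f i)) :
    ∫⁻ x, ∏ i, f i (x i) ∂(Measure.pi ν) = ∏ i, ∫⁻ y, f i y ∂(ν i) := by
  have h := lintegral_prod_eq_prod_lintegral_of_indepFun (μ := Measure.pi ν) Finset.univ
    (fun i x => f i (x i)) (iIndepFun_pi (X := fun i => f i) fun i => (hf i).aemeasurable)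
    (fun i => (hf i).comp (measurable_pi_apply i))
  rw [h]
  refine Finset.prod_congr rfl fun i _ => ?_
  rw [← (measurePreserving_eval ν i).lintegral_comp (hf i)]

/-- Completing the square turns the integrand into `C` times another Gaussian density, so the
integral is `C`. The range t ≤ 1/8 is what permits the clean constants 3/2 and 2/3. -/
lemma lintegral_exp_quadratic_gaussianReal {t : ℝ} (ht0 : 0 ≤ t) (ht : t ≤ 1 / 8) (s : ℝ) :
    ∫⁻ x, ENNReal.ofReal (Real.exp (t * x ^ 2 + s * x)) ∂(gaussianReal 0 1)
      ≤ ENNReal.ofReal (Real.exp (3 / 2 * t + 2 / 3 * s ^ 2)) := by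
  have hp : 0 < 1 - 2 * t := by linarith
  set v : ℝ≥0 := ⟨(1 - 2 * t)⁻¹, by positivity⟩ with hv
  have hvr : (v : ℝ) = (1 - 2 * t)⁻¹ := rfl
  have hv0 : v ≠ 0 := by
    intro h
    have : (v : ℝ) = 0 := by rw [h]; rfl
    rw [hvr] at this
    exact hp.ne' (inv_eq_zero.1 this)
  set m : ℝ := s / (1 - 2 * t) with hm
  set C : ℝ := √(v : ℝ) * Real.exp (s ^ 2 / (2 * (1 - 2 * t))) with hC
  have hpt : ∀ x : ℝ, gaussianPDFReal 0 1 x * Real.exp (t * x ^ 2 + s * x)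
      = C * gaussianPDFReal m v x := by
    intro x
    simp only [gaussianPDFReal, hC, NNReal.coe_one, mul_one, sub_zero]
    have h1 : √(2 * Real.pi * v) = √(2 * Real.pi) * √(v : ℝ) := Real.sqrt_mul (by positivity) _
    have hsv : 0 < √(v : ℝ) := Real.sqrt_pos.2 (by rw [hvr]; positivity)
    have hpi : 0 < √(2 * Real.pi) := Real.sqrt_pos.2 (by positivity)
    rw [h1, mul_assoc, ← Real.exp_add, mul_inv,
      show √(v : ℝ) * Real.exp (s ^ 2 / (2 * (1 - 2 * t))) *
        ((√(2 * Real.pi))⁻¹ * (√(v : ℝ))⁻¹ * Real.exp (-(x - m) ^ 2 / (2 * v))) =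
        (√(v : ℝ) * (√(v : ℝ))⁻¹) * ((√(2 * Real.pi))⁻¹ *
        (Real.exp (s ^ 2 / (2 * (1 - 2 * t))) * Real.exp (-(x - m) ^ 2 / (2 * v)))) by ring,
      mul_inv_cancel₀ hsv.ne', one_mul, ← Real.exp_add]
    congr 2
    rw [hvr, hm]
    field_simp
    ring
  have hCle : C ≤ Real.exp (3 / 2 * t + 2 / 3 * s ^ 2) := by
    rw [hC, Real.exp_add]
    gcongr
    · rw [Real.sqrt_le_left (by positivity), ← Real.exp_nat_mul, hvr]
      rw [inv_le_comm₀ hp (by positivity), ← Real.exp_neg]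
      -- The normalizing factor (1-2t)^(-1/2) is at most exp(3t/2) because (1-2t)⁻¹ ≤ 1 + 3t ≤
      -- exp(3t).
      have h1 : (1 : ℝ) ≤ (1 - 2 * t) * (1 + 3 * t) := by nlinarith
      have h2 : 1 + 3 * t ≤ Real.exp (3 * t) := by linarith [Real.add_one_le_exp (3 * t)]
      have h3 : (-(((2 : ℕ) : ℝ) * (3 / 2 * t))) = -(3 * t) := by push_cast; ring
      rw [h3, Real.exp_neg, inv_le_comm₀ (by positivity) hp]
      calc (1 - 2 * t)⁻¹ ≤ 1 + 3 * t := by rw [inv_le_iff_one_le_mul₀ hp]; linarith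
        _ ≤ _ := h2
    · rw [div_le_iff₀ (by positivity)]
      nlinarith [sq_nonneg s, mul_nonneg (sq_nonneg s) (by linarith : (0 : ℝ) ≤ 1 / 8 - t)]
  rw [gaussianReal_of_var_ne_zero _ one_ne_zero,
    lintegral_withDensity_eq_lintegral_mul _ (measurable_gaussianPDF 0 1) (by fun_prop)]
  calc ∫⁻ x, (gaussianPDF 0 1 * fun x => ENNReal.ofReal (Real.exp (t * x ^ 2 + s * x))) x
      = ∫⁻ x, ENNReal.ofReal C * gaussianPDF m v x := by
        refine lintegral_congr fun x => ?_
        rw [Pi.mul_apply, gaussianPDF, gaussianPDF, ← ENNReal.ofReal_mul (gaussianPDFReal_nonneg _ _ _),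
          hpt, ENNReal.ofReal_mul (by positivity)]
    _ = ENNReal.ofReal C := by
        rw [lintegral_const_mul _ (measurable_gaussianPDF _ _), lintegral_gaussianPDF_eq_one _ hv0,
          mul_one]
    _ ≤ _ := ENNReal.ofReal_le_ofReal hCle

lemma gaussianReal_eq_withDensity_shift (m : ℝ) :
    gaussianReal m 1 = (gaussianReal 0 1).withDensity
      (fun x => ENNReal.ofReal (Real.exp (m * x - m ^ 2 / 2))) := by
  rw [gaussianReal_of_var_ne_zero _ one_ne_zero, gaussianReal_of_var_ne_zero _ one_ne_zero,
    ← withDensity_mul _ (measurable_gaussianPDF 0 1) (by fun_prop)]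
  congr 1
  funext x
  rw [Pi.mul_apply, gaussianPDF, gaussianPDF, ← ENNReal.ofReal_mul (gaussianPDFReal_nonneg _ _ _)]
  congr 1
  simp only [gaussianPDFReal, NNReal.coe_one, mul_one, sub_zero]
  rw [mul_assoc, ← Real.exp_add]
  congr 2
  ring

lemma pi_gaussianReal_eq_withDensity_shift {ι : Type*} [Fintype ι] (m : ι → ℝ) :
    Measure.pi (fun i => gaussianReal (m i) 1) =
      (Measure.pi (fun _ : ι => gaussianReal 0 1)).withDensity
      (fun x => ∏ i, ENNReal.ofReal (Real.exp (m i * x i - m i ^ 2 / 2))) := by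
  refine Measure.pi_eq fun s hs => ?_
  rw [withDensity_apply _ (MeasurableSet.univ_pi hs),
    ← lintegral_indicator (MeasurableSet.univ_pi hs)]
  have h : ∀ x : ι → ℝ, (Set.univ.pi s).indicator
      (fun x => ∏ i, ENNReal.ofReal (Real.exp (m i * x i - m i ^ 2 / 2))) x
      = ∏ i, (s i).indicator (fun y => ENNReal.ofReal (Real.exp (m i * y - m i ^ 2 / 2))) (x i) := by
    intro x
    by_cases hx : x ∈ Set.univ.pi s
    · rw [Set.indicator_of_mem hx]
      refine Finset.prod_congr rfl fun i _ => ?_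
      rw [Set.indicator_of_mem (hx i (Set.mem_univ i))]
    · rw [Set.indicator_of_notMem hx]
      simp only [Set.mem_univ_pi, not_forall] at hx
      obtain ⟨i, hi⟩ := hx
      exact (Finset.prod_eq_zero (Finset.mem_univ i) (Set.indicator_of_notMem hi _)).symm
  simp_rw [h]
  rw [lintegral_pi_prod_eq_prod _ (fun i => (s i).indicator
    (fun y => ENNReal.ofReal (Real.exp (m i * y - m i ^ 2 / 2))))
    (fun i => Measurable.indicator (by fun_prop) (hs i))]
  refine Finset.prod_congr rfl fun i _ => ?_
  rw [lintegral_indicator (hs i), gaussianReal_eq_withDensity_shift (m i),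
    withDensity_apply _ (hs i)]

variable {d : ℕ}

lemma lintegral_stdGaussian (F : State d → ENNReal) (hF : Measurable F) :
    ∫⁻ x, F x ∂(stdGaussian (State d))
      = ∫⁻ y, F (WithLp.toLp 2 y) ∂(Measure.pi fun _ : Fin d => gaussianReal 0 1) := by
  rw [← map_pi_eq_stdGaussian, lintegral_map hF (by fun_prop)]

lemma lintegral_exp_quadratic_stdGaussian (t s : Fin d → ℝ) (ht0 : ∀ j, 0 ≤ t j)
    (ht : ∀ j, t j ≤ 1 / 8) :
    ∫⁻ x, ENNReal.ofReal (Real.exp (∑ j, (t j * x j ^ 2 + s j * x j))) ∂(stdGaussian (State d))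
      ≤ ENNReal.ofReal (Real.exp (∑ j, (3 / 2 * t j + 2 / 3 * s j ^ 2))) := by
  rw [lintegral_stdGaussian _ (by fun_prop)]
  simp_rw [Real.exp_sum]
  rw [ENNReal.ofReal_prod_of_nonneg (fun _ _ => (Real.exp_pos _).le)]
  simp_rw [ENNReal.ofReal_prod_of_nonneg (fun (i : Fin d) (_ : i ∈ Finset.univ) =>
    (Real.exp_pos _).le)]
  rw [lintegral_pi_prod_eq_prod _ (fun j y => ENNReal.ofReal (Real.exp (t j * y ^ 2 + s j * y)))
    (fun j => by fun_prop)]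
  exact Finset.prod_le_prod' fun j _ => lintegral_exp_quadratic_gaussianReal (ht0 j) (ht j) (s j)

lemma lintegral_stdGaussian_shift (F : State d → ENNReal) (hF : Measurable F) (m : State d) :
    ∫⁻ x, F (m + x) ∂(stdGaussian (State d))
      = ∫⁻ x, ENNReal.ofReal (Real.exp (∑ j, (m j * x j - m j ^ 2 / 2))) * F x
          ∂(stdGaussian (State d)) := by
  rw [lintegral_stdGaussian _ (by fun_prop), lintegral_stdGaussian _ (by fun_prop)]
  have h1 : Measure.pi (fun i => gaussianReal (m i) 1)
      = (Measure.pi fun _ : Fin d => gaussianReal 0 1).map (fun y i => m i + y i) := by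
    rw [Measure.pi_map_pi (f := fun i y => m i + y) (fun i => by fun_prop)]
    congr 1
    funext i
    rw [gaussianReal_map_const_add]
    simp
  have h2 : ∫⁻ y, F (WithLp.toLp 2 y) ∂(Measure.pi (fun i => gaussianReal (m i) 1))
      = ∫⁻ y, F (m + WithLp.toLp 2 y) ∂(Measure.pi fun _ : Fin d => gaussianReal 0 1) := by
    rw [h1, lintegral_map (by fun_prop) (by fun_prop)]
    rfl
  rw [← h2, pi_gaussianReal_eq_withDensity_shift,
    lintegral_withDensity_eq_lintegral_mul _ (by fun_prop) (by fun_prop)]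
  refine lintegral_congr fun y => ?_
  rw [Pi.mul_apply, Real.exp_sum, ENNReal.ofReal_prod_of_nonneg (fun _ _ => (Real.exp_pos _).le)]

lemma lintegral_exp_linear_stdGaussian (m : State d) :
    ∫⁻ x, ENNReal.ofReal (Real.exp (∑ j, (m j * x j - m j ^ 2 / 2))) ∂(stdGaussian (State d))
      = 1 := by
  have h := lintegral_stdGaussian_shift (fun _ => 1) measurable_const m
  simpa using h.symm

lemma integrable_of_mem_unit {α : Type*} [MeasurableSpace α] {ν : Measure α}
    [IsProbabilityMeasure ν] {A : α → ℝ} (hA : Measurable A) (h0 : ∀ x, 0 ≤ A x)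
    (h1 : ∀ x, A x ≤ 1) : Integrable A ν :=
  Integrable.of_bound hA.aestronglyMeasurable 1 (Filter.Eventually.of_forall fun x => by
    rw [Real.norm_eq_abs, abs_of_nonneg (h0 x)]; exact h1 x)

/-- Cauchy–Schwarz for A = (√w A)(1/√w), where w is the Cameron–Martin density of the shift: ∫ wA² ≤
∫ wA since A ≤ 1, and ∫ 1/w = exp(‖m‖²). -/
lemma sq_integral_le_integral_shift (A : State d → ℝ) (hA : Measurable A) (h0 : ∀ x, 0 ≤ A x)
    (h1 : ∀ x, A x ≤ 1) (m : State d) :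
    (∫ x, A x ∂(stdGaussian (State d))) ^ 2 * Real.exp (-‖m‖ ^ 2)
      ≤ ∫ x, A (m + x) ∂(stdGaussian (State d)) := by
  set γ := stdGaussian (State d)
  set I := ∫ x, A (m + x) ∂γ with hI
  set k := ∫ x, A x ∂γ with hk
  have hI0 : 0 ≤ I := integral_nonneg fun x => h0 _
  have hk0 : 0 ≤ k := integral_nonneg fun x => h0 _
  set w : State d → ℝ := fun x => Real.exp (∑ j, (m j * x j - m j ^ 2 / 2)) with hw
  have hm2 : ‖m‖ ^ 2 = ∑ j, m j ^ 2 := by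
    rw [EuclideanSpace.norm_sq_eq]; simp
  have hwm : Measurable w := by fun_prop
  have hwinv : ∀ x, (w x)⁻¹ = Real.exp (‖m‖ ^ 2) *
      Real.exp (∑ j, ((-m) j * x j - (-m) j ^ 2 / 2)) := by
    intro x
    rw [hw, ← Real.exp_neg, ← Real.exp_add, hm2, ← Finset.sum_neg_distrib, ← Finset.sum_add_distrib]
    congr 1
    refine Finset.sum_congr rfl fun j _ => ?_
    simp
    ring
  have hIl : ENNReal.ofReal I = ∫⁻ x, ENNReal.ofReal (w x) * ENNReal.ofReal (A x) ∂γ := by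
    rw [hI, ofReal_integral_eq_lintegral_ofReal
      (integrable_of_mem_unit (by fun_prop) (fun x => h0 _) fun x => h1 _)
      (Filter.Eventually.of_forall fun x => h0 _)]
    exact lintegral_stdGaussian_shift (fun x => ENNReal.ofReal (A x)) (by fun_prop) m
  have hwi : ∫⁻ x, ENNReal.ofReal ((w x)⁻¹) ∂γ = ENNReal.ofReal (Real.exp (‖m‖ ^ 2)) := by
    simp_rw [hwinv]
    have : ∀ x : State d, ENNReal.ofReal (Real.exp (‖m‖ ^ 2) *
        Real.exp (∑ j, ((-m) j * x j - (-m) j ^ 2 / 2))) = ENNReal.ofReal (Real.exp (‖m‖ ^ 2)) *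
        ENNReal.ofReal (Real.exp (∑ j, ((-m) j * x j - (-m) j ^ 2 / 2))) :=
      fun x => ENNReal.ofReal_mul (Real.exp_pos _).le
    simp_rw [this]
    rw [lintegral_const_mul _ (by fun_prop), lintegral_exp_linear_stdGaussian, mul_one]
  -- Cauchy–Schwarz in its additive form A ≤ (c/2)wA + 1/(2cw), which holds pointwise because A² ≤
  -- A.
  have key : ∀ c : ℝ, 0 < c → k ≤ c / 2 * I + Real.exp (‖m‖ ^ 2) / (2 * c) := by
    intro c hc
    rw [← ENNReal.ofReal_le_ofReal_iff (by positivity), ENNReal.ofReal_add (by positivity)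
      (by positivity), ENNReal.ofReal_mul (by positivity), hIl, div_eq_inv_mul _ (2 * c),
      ENNReal.ofReal_mul (by positivity), ← hwi, ← lintegral_const_mul _ (by fun_prop),
      ← lintegral_const_mul _ (by fun_prop), ← lintegral_add_left (by fun_prop), hk,
      ofReal_integral_eq_lintegral_ofReal (integrable_of_mem_unit hA h0 h1)
      (Filter.Eventually.of_forall h0)]
    refine lintegral_mono fun x => ?_
    have hwx : 0 < w x := Real.exp_pos _
    rw [← ENNReal.ofReal_mul hwx.le, ← ENNReal.ofReal_mul (by positivity),
      ← ENNReal.ofReal_mul (by positivity),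
      ← ENNReal.ofReal_add (by have := h0 x; positivity) (by positivity)]
    refine ENNReal.ofReal_le_ofReal ?_
    have hx0 := h0 x
    have hx1 := h1 x
    have hsq : A x ^ 2 ≤ A x := by nlinarith
    rw [← mul_inv, inv_eq_one_div, ← sub_nonneg]
    have e : c / 2 * (w x * A x) + 1 / (2 * c * w x) - A x
      = ((c * w x * A x - 1) ^ 2 + (c * w x) ^ 2 * (A x - A x ^ 2)) / (2 * c * w x) := by
      field_simp
      ring
    rw [e]
    exact div_nonneg (add_nonneg (sq_nonneg _) (mul_nonneg (sq_nonneg _) (by linarith)))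
      (by positivity)
  rcases hk0.eq_or_lt with h | h
  · rw [← h]; simpa using hI0
  -- This value of c makes the second term equal to k/2, half of the left side.
  · have h2 := key (Real.exp (‖m‖ ^ 2) / k) (by positivity)
    rw [Real.exp_neg, ← div_eq_mul_inv, div_le_iff₀ (Real.exp_pos _)]
    have h3 : Real.exp (‖m‖ ^ 2) / (2 * (Real.exp (‖m‖ ^ 2) / k)) = k / 2 := by
      field_simp
    rw [h3] at h2
    have h4 : k / 2 ≤ Real.exp (‖m‖ ^ 2) / k / 2 * I := by linarith
    have h5 := mul_le_mul_of_nonneg_right h4 (by positivity : 0 ≤ 2 * k)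
    have h6 : Real.exp (‖m‖ ^ 2) / k / 2 * I * (2 * k) = I * Real.exp (‖m‖ ^ 2) := by
      field_simp
    nlinarith

lemma integral_stdGaussian_neg (h : State d → ℝ) :
    ∫ x, h (-x) ∂(stdGaussian (State d)) = ∫ x, h x ∂(stdGaussian (State d)) := by
  have e := stdGaussian_map (LinearIsometryEquiv.neg ℝ (E := State d))
  conv_rhs => rw [← e]
  exact ((LinearIsometryEquiv.neg ℝ (E := State d)).toHomeomorph.measurableEmbedding.integral_map
    h).symm

lemma map_inner_stdGaussian (u : State d) (hu : ‖u‖ = 1) :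
    (stdGaussian (State d)).map (fun x => inner ℝ u x) = gaussianReal 0 1 := by
  have h := IsGaussian.map_eq_gaussianReal (μ := stdGaussian (State d)) (innerSL ℝ u)
  rw [integral_strongDual_stdGaussian, variance_dual_stdGaussian, innerSL_apply_norm, hu] at h
  simpa using h

lemma integral_inner_stdGaussian (u : State d) (hu : ‖u‖ = 1) (h : ℝ → ℝ) (hh : Measurable h) :
    ∫ x, h (inner ℝ u x) ∂(stdGaussian (State d)) = ∫ y, h y ∂(gaussianReal 0 1) := by
  rw [← map_inner_stdGaussian u hu, integral_map (by fun_prop) hh.aestronglyMeasurable]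

end Gaussian

/-! ### Exponential supermartingales along the trajectory -/

section Chain

variable {d : ℕ} {Ω : Type*} [MeasurableSpace Ω]

lemma trajectory_congr (f : State d → State d) {e e' : ℕ → State d} {k : ℕ}
    (h : ∀ i < k, e i = e' i) : trajectory f e k = trajectory f e' k := by
  induction k with
  | zero => rfl
  | succ k ih =>
    simp only [trajectory]
    rw [ih fun i hi => h i (hi.trans (Nat.lt_succ_self k)), h k (Nat.lt_succ_self k)]

lemma measurable_trajectory {f : State d → State d} (hf : Measurable f) {α : Type*}
    [MeasurableSpace α] {e : ℕ → α → State d} {k : ℕ} (he : ∀ i < k, Measurable (e i)) :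
    Measurable fun a => trajectory f (fun i => e i a) k := by
  induction k with
  | zero => exact measurable_const
  | succ k ih =>
    simp only [trajectory]
    exact (hf.comp (ih fun i hi => he i (hi.trans (Nat.lt_succ_self k)))).add
      (he k (Nat.lt_succ_self k))

/-- The state at time k and the sum accumulated so far are functions of ε_0, …, ε_{k-1} alone. -/
lemma indepFun_trajectory {μ : Measure Ω} {n : ℕ} {ε : ℕ → Ω → State d}
    (hm : ∀ i ≤ n, Measurable (ε i)) (hind : iIndepFun (fun i : Fin (n + 1) => ε i) μ)
    {f : State d → State d} (hf : Measurable f) {g : State d → State d → ℝ}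
    (hg : Measurable (Function.uncurry g)) {k : ℕ} (hk : k ≤ n) :
    IndepFun (fun ω => (trajectory f (fun i => ε i ω) k,
      ∑ i ∈ Finset.range k, g (trajectory f (fun i => ε i ω) i) (ε i ω))) (ε k) μ := by
  classical
  set S : Finset (Fin (n + 1)) := Finset.univ.filter fun i => i.val < k with hS
  have hlt : k < n + 1 := Nat.lt_succ_of_le hk
  set T : Finset (Fin (n + 1)) := {⟨k, hlt⟩} with hT
  have hdisj : Disjoint S T := by
    rw [hT, Finset.disjoint_singleton_right, hS]
    simp
  have hbase := hind.indepFun_finset S T hdisj fun i => hm i (Nat.lt_succ_iff.1 i.2)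
  have hmemS : ∀ i (h : i < k), (⟨i, h.trans hlt⟩ : Fin (n + 1)) ∈ S := fun i h => by
    rw [hS]; simpa using h
  -- The past noises, extended by 0; the value 0 is never read, since only indices below k occur in
  -- the trajectory up to time k.
  set ext : ℕ → (S → State d) → State d := fun i y =>
    if h : i < k then y ⟨⟨i, h.trans hlt⟩, hmemS i h⟩ else 0 with hext
  have hextm : ∀ i, Measurable (ext i) := fun i => by
    by_cases h : i < k
    · simp only [hext, h, dif_pos]; fun_prop
    · simp only [hext, h, dif_neg, not_false_iff]; fun_prop
  set Ψ : (S → State d) → State d × ℝ := fun y =>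
    (trajectory f (fun i => ext i y) k,
      ∑ i ∈ Finset.range k, g (trajectory f (fun i => ext i y) i) (ext i y)) with hΨ
  have hΨm : Measurable Ψ := by
    refine (measurable_trajectory hf fun i _ => hextm i).prodMk ?_
    refine Finset.measurable_sum _ fun i _ => ?_
    exact hg.comp ((measurable_trajectory hf fun i _ => hextm i).prodMk (hextm i))
  have hkT : (⟨k, hlt⟩ : Fin (n + 1)) ∈ T := by simp [hT]
  have h := hbase.comp hΨm (measurable_pi_apply (⟨⟨k, hlt⟩, hkT⟩ : T))
  have hagree : ∀ ω i, i < k → ext i (fun j : S => ε j ω) = ε i ω := fun ω i hi => by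
    simp [hext, hi]
  have e1 : (Ψ ∘ fun a (i : S) => ε i a) = fun ω => (trajectory f (fun i => ε i ω) k,
      ∑ i ∈ Finset.range k, g (trajectory f (fun i => ε i ω) i) (ε i ω)) := by
    funext ω
    simp only [Function.comp, hΨ]
    rw [Prod.mk.injEq]
    refine ⟨trajectory_congr f fun i hi => hagree ω i hi, Finset.sum_congr rfl fun i hi => ?_⟩
    rw [Finset.mem_range] at hi
    rw [hagree ω i hi, trajectory_congr f fun j hj => hagree ω j (hj.trans hi)]
  rw [e1] at h
  exact h

/-- The partial exponentials form a supermartingale. By independence the last noise can be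
integrated out with the past frozen, and `hg1` bounds that factor by 1. -/
theorem lintegral_exp_sum_le_one {μ : Measure Ω} [IsProbabilityMeasure μ] {n : ℕ}
    {ε : ℕ → Ω → State d} (hm : ∀ i ≤ n, Measurable (ε i))
    (hind : iIndepFun (fun i : Fin (n + 1) => ε i) μ) {γ : Measure (State d)}
    [IsProbabilityMeasure γ] (hlaw : ∀ i ≤ n, μ.map (ε i) = γ)
    {f : State d → State d} (hf : Measurable f) {g : State d → State d → ℝ}
    (hg : Measurable (Function.uncurry g))
    (hg1 : ∀ x, ∫⁻ e, ENNReal.ofReal (Real.exp (g x e)) ∂γ ≤ 1) {k : ℕ} (hk : k ≤ n + 1) :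
    ∫⁻ ω, ENNReal.ofReal (Real.exp (∑ i ∈ Finset.range k,
      g (trajectory f (fun i => ε i ω) i) (ε i ω))) ∂μ ≤ 1 := by
  induction k with
  | zero => simp
  | succ k ih =>
    have hkn : k ≤ n := Nat.le_of_succ_le_succ hk
    have hind' := indepFun_trajectory hm hind hf hg hkn
    set Y : Ω → State d × ℝ := fun ω => (trajectory f (fun i => ε i ω) k,
      ∑ i ∈ Finset.range k, g (trajectory f (fun i => ε i ω) i) (ε i ω)) with hY
    have hYm : Measurable Y := by
      refine (measurable_trajectory hf fun i hi => hm i (hi.le.trans hkn)).prodMk ?_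
      refine Finset.measurable_sum _ fun i hi => ?_
      rw [Finset.mem_range] at hi
      exact hg.comp ((measurable_trajectory hf fun j hj => hm j ((hj.trans hi).le.trans hkn)).prodMk
        (hm i (hi.le.trans hkn)))
    have hYk : (fun ω => Y ω) = Y := rfl
    set H : (State d × ℝ) × State d → ENNReal := fun p =>
      ENNReal.ofReal (Real.exp p.1.2) * ENNReal.ofReal (Real.exp (g p.1.1 p.2)) with hH
    have hHm : Measurable H := by
      have : Measurable fun p : (State d × ℝ) × State d => g p.1.1 p.2 :=
        hg.comp (by fun_prop : Measurable fun p : (State d × ℝ) × State d => (p.1.1, p.2))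
      exact (by fun_prop : Measurable fun p : (State d × ℝ) × State d =>
        ENNReal.ofReal (Real.exp p.1.2)).mul (by fun_prop)
    have hmap := (indepFun_iff_map_prod_eq_prod_map_map hYm.aemeasurable
      (hm k hkn).aemeasurable).1 hind'
    rw [hlaw k hkn] at hmap
    have hprob : IsProbabilityMeasure (μ.map Y) := Measure.isProbabilityMeasure_map hYm.aemeasurable
    calc ∫⁻ ω, ENNReal.ofReal (Real.exp (∑ i ∈ Finset.range (k + 1),
          g (trajectory f (fun i => ε i ω) i) (ε i ω))) ∂μ
        = ∫⁻ ω, H (Y ω, ε k ω) ∂μ := by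
          refine lintegral_congr fun ω => ?_
          rw [Finset.sum_range_succ, Real.exp_add, ENNReal.ofReal_mul (Real.exp_pos _).le]
      _ = ∫⁻ p, H p ∂((μ.map Y).prod γ) := by
          rw [← hmap, lintegral_map hHm (hYm.prodMk (hm k hkn))]
      _ = ∫⁻ y, ∫⁻ e, H (y, e) ∂γ ∂(μ.map Y) := lintegral_prod _ hHm.aemeasurable
      _ ≤ ∫⁻ y, ENNReal.ofReal (Real.exp y.2) ∂(μ.map Y) := by
          refine lintegral_mono fun y => ?_
          simp only [hH]
          rw [lintegral_const_mul' _ _ ENNReal.ofReal_ne_top]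
          exact mul_le_of_le_one_right' (hg1 y.1)
      _ = ∫⁻ ω, ENNReal.ofReal (Real.exp (Y ω).2) ∂μ := by
          rw [lintegral_map (by fun_prop) hYm]
      _ ≤ 1 := ih (hkn.trans (Nat.le_succ n))

theorem measure_exp_sum_ge_le {μ : Measure Ω} [IsProbabilityMeasure μ] {n : ℕ}
    {ε : ℕ → Ω → State d} (hm : ∀ i ≤ n, Measurable (ε i))
    (hind : iIndepFun (fun i : Fin (n + 1) => ε i) μ) {γ : Measure (State d)}
    [IsProbabilityMeasure γ] (hlaw : ∀ i ≤ n, μ.map (ε i) = γ)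
    {f : State d → State d} (hf : Measurable f) {g : State d → State d → ℝ}
    (hg : Measurable (Function.uncurry g))
    (hg1 : ∀ x, ∫⁻ e, ENNReal.ofReal (Real.exp (g x e)) ∂γ ≤ 1) {k : ℕ} (hk : k ≤ n + 1)
    {p : ℝ} (hp : 0 < p) :
    μ {ω | Real.log (1 / p) ≤ ∑ i ∈ Finset.range k,
      g (trajectory f (fun i => ε i ω) i) (ε i ω)} ≤ ENNReal.ofReal p := by
  have hint := lintegral_exp_sum_le_one hm hind hlaw hf hg hg1 hk
  have hmeas : Measurable fun ω => ENNReal.ofReal (Real.exp (∑ i ∈ Finset.range k,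
      g (trajectory f (fun i => ε i ω) i) (ε i ω))) := by
    have : Measurable fun ω => ∑ i ∈ Finset.range k,
        g (trajectory f (fun i => ε i ω) i) (ε i ω) := by
      refine Finset.measurable_sum _ fun i hi => ?_
      rw [Finset.mem_range] at hi
      have hin : i ≤ n := Nat.lt_succ_iff.1 (hi.trans_le hk)
      exact hg.comp ((measurable_trajectory hf fun j hj => hm j (hj.le.trans hin)).prodMk (hm i hin))
    fun_prop
  have hmarkov := mul_meas_ge_le_lintegral (μ := μ) hmeas (ENNReal.ofReal (1 / p))
  have hsub : {ω | Real.log (1 / p) ≤ ∑ i ∈ Finset.range k,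
      g (trajectory f (fun i => ε i ω) i) (ε i ω)} ⊆
      {ω | ENNReal.ofReal (1 / p) ≤ ENNReal.ofReal (Real.exp (∑ i ∈ Finset.range k,
      g (trajectory f (fun i => ε i ω) i) (ε i ω)))} := by
    intro ω hω
    refine ENNReal.ofReal_le_ofReal ?_
    replace hω : Real.log (1 / p) ≤ _ := hω
    calc 1 / p = Real.exp (Real.log (1 / p)) := (Real.exp_log (by positivity)).symm
      _ ≤ _ := Real.exp_le_exp.2 hω
  refine (measure_mono hsub).trans ?_
  have h1 := hmarkov.trans hint
  have hp0 : ENNReal.ofReal p ≠ 0 := by simpa using hp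
  rw [one_div, ENNReal.ofReal_inv_of_pos hp] at h1 ⊢
  rwa [ENNReal.inv_mul_le_iff hp0 ENNReal.ofReal_ne_top, mul_one] at h1

end Chain

/-! ### Anti-concentration of ReLU increments at all scales -/

section Dichotomy

/-- The constant of the anti-concentration bounds for ReLU increments. -/
noncomputable def smallBall : ℝ := (∫ y, min (y ^ 2) 1 ∂(gaussianReal 0 1)) / 8

lemma smallBall_pos : 0 < smallBall := by
  have hi : Integrable (fun y : ℝ => min (y ^ 2) 1) (gaussianReal 0 1) :=
    integrable_of_mem_unit (by fun_prop) (fun y => by positivity) fun y => min_le_right _ _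
  have h : 0 < ∫ y, min (y ^ 2) 1 ∂(gaussianReal 0 1) := by
    rw [integral_pos_iff_support_of_nonneg (fun y => by positivity) hi]
    have hs : Function.support (fun y : ℝ => min (y ^ 2) 1) = {0}ᶜ := by
      ext y
      simp only [Function.mem_support, Set.mem_compl_iff, Set.mem_singleton_iff]
      constructor
      · rintro h rfl
        simp at h
      · intro h
        exact (lt_min (by positivity) one_pos).ne'
    have hn : NullSingletonClass (gaussianReal 0 1) := nullSingletonClass_gaussianReal one_ne_zero
    rw [hs, prob_compl_eq_one_sub (measurableSet_singleton 0), measure_singleton]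
    simp
  unfold smallBall
  positivity

lemma smallBall_le_one : smallBall ≤ 1 := by
  have h : ∫ y, min (y ^ 2) 1 ∂(gaussianReal 0 1) ≤ ∫ _, (1 : ℝ) ∂(gaussianReal 0 1) :=
    integral_mono (integrable_of_mem_unit (by fun_prop) (fun y => by positivity)
      fun y => min_le_right _ _) (integrable_const _) fun y => min_le_right _ _
  simp only [integral_const, probReal_univ, smul_eq_mul, mul_one] at h
  unfold smallBall
  linarith

/-- The capped squared ReLU increment on the half space `0 ≤ a`. -/
noncomputable def incOn (s a b : ℝ) : ℝ := if 0 ≤ a then min (max b (-(s * a)) ^ 2) 1 else 0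

/-- The capped squared ReLU increment on the half space `a < 0`. -/
noncomputable def incOff (s a b : ℝ) : ℝ := if a < 0 then min (max (s * a + b) 0 ^ 2) 1 else 0

lemma incOn_nonneg (s a b : ℝ) : 0 ≤ incOn s a b := by unfold incOn; split_ifs <;> positivity

lemma incOff_nonneg (s a b : ℝ) : 0 ≤ incOff s a b := by unfold incOff; split_ifs <;> positivity

lemma incOn_le_one (s a b : ℝ) : incOn s a b ≤ 1 := by
  unfold incOn; split_ifs
  · exact min_le_right _ _
  · exact zero_le_one

lemma incOff_le_one (s a b : ℝ) : incOff s a b ≤ 1 := by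
  unfold incOff; split_ifs
  · exact min_le_right _ _
  · exact zero_le_one

lemma incOn_add_incOff {s : ℝ} (hs : 0 ≤ s) (a b : ℝ) :
    incOn s a b + incOff s a b = min ((max (s * a + b) 0 - max (s * a) 0) ^ 2) 1 := by
  unfold incOn incOff
  rcases le_or_gt 0 a with ha | ha
  · rw [if_pos ha, if_neg ha.not_gt, add_zero, max_eq_left (mul_nonneg hs ha)]
    congr 2
    rcases le_total 0 (s * a + b) with h | h
    · rw [max_eq_left h, max_eq_left (by linarith)]; ring
    · rw [max_eq_right h, max_eq_right (by linarith)]; ring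
  · rw [if_neg ha.not_ge, if_pos ha, zero_add,
      max_eq_right (mul_nonpos_of_nonneg_of_nonpos hs ha.le), sub_zero]

/-- On the active side the increment is b itself if b ≥ 0, and otherwise it is b truncated from
below at -sa, a truncation that loosens as s grows. -/
lemma incOn_mono {s t : ℝ} (hs : 0 ≤ s) (hst : s ≤ t) (a b : ℝ) : incOn s a b ≤ incOn t a b := by
  unfold incOn
  split_ifs with ha
  · refine min_le_min_right _ ?_
    have h1 : s * a ≤ t * a := mul_le_mul_of_nonneg_right hst ha
    have h2 : 0 ≤ s * a := mul_nonneg hs ha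
    rcases le_total 0 b with hb | hb
    · rw [max_eq_left (by linarith), max_eq_left (by linarith)]
    · have h3 : max b (-(t * a)) ≤ max b (-(s * a)) := max_le_max_left _ (by linarith)
      have h4 : max b (-(s * a)) ≤ 0 := max_le hb (by linarith)
      nlinarith
  · exact le_rfl

lemma incOff_anti {s t : ℝ} (hst : s ≤ t) (a b : ℝ) : incOff t a b ≤ incOff s a b := by
  unfold incOff
  split_ifs with ha
  · refine min_le_min_right _ ?_
    have h1 : t * a ≤ s * a := mul_le_mul_of_nonpos_right hst ha.le
    have h3 : max (t * a + b) 0 ≤ max (s * a + b) 0 := max_le_max_right _ (by linarith)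
    exact pow_le_pow_left₀ (le_max_right _ _) h3 2
  · exact le_rfl

lemma continuous_incOn (a b : ℝ) : Continuous fun s => incOn s a b := by
  unfold incOn; split_ifs <;> fun_prop

/-- From z = max(z,0) - max(-z,0), the number b is the increment at (a,b) minus the increment at
(-a,-b), so the two cannot both be small. -/
lemma min_sq_le_relu_increments {s a b : ℝ} :
    min (b ^ 2) 1 ≤ 2 * min ((max (s * a + b) 0 - max (s * a) 0) ^ 2) 1 +
      2 * min ((max (s * (-a) + (-b)) 0 - max (s * (-a)) 0) ^ 2) 1 := by
  have hrelu : ∀ z : ℝ, max z 0 - max (-z) 0 = z := fun z => by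
    rcases le_total 0 z with h | h
    · rw [max_eq_left h, max_eq_right (by linarith), sub_zero]
    · rw [max_eq_right h, max_eq_left (by linarith)]; ring
  set p := max (s * a + b) 0 - max (s * a) 0
  set q := max (s * (-a) + (-b)) 0 - max (s * (-a)) 0
  have hb : b = p - q := by
    have h1 := hrelu (s * a + b)
    have h2 := hrelu (s * a)
    have e1 : -(s * a + b) = s * (-a) + (-b) := by ring
    have e2 : -(s * a) = s * (-a) := by ring
    rw [e1] at h1
    rw [e2] at h2
    simp only [p, q]
    linarith
  have hsq : b ^ 2 ≤ 2 * p ^ 2 + 2 * q ^ 2 := by rw [hb]; nlinarith [sq_nonneg (p + q)]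
  have hp0 := sq_nonneg p
  have hq0 := sq_nonneg q
  rcases le_total (p ^ 2) 1 with hp | hp <;> rcases le_total (q ^ 2) 1 with hq | hq
  · rw [min_eq_left hp, min_eq_left hq]
    exact (min_le_left _ _).trans hsq
  all_goals
    refine (min_le_right _ _).trans ?_
    first | rw [min_eq_right hp] | rw [min_eq_left hp]
    first | rw [min_eq_right hq] | rw [min_eq_left hq]
    linarith

variable {d : ℕ}

lemma measurable_incOn (s : ℝ) (w u : State d) :
    Measurable fun x : State d => incOn s (inner ℝ w x) (inner ℝ u x) := by
  unfold incOn
  exact Measurable.ite (measurableSet_le measurable_const (by fun_prop)) (by fun_prop)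
    measurable_const

lemma measurable_incOff (s : ℝ) (w u : State d) :
    Measurable fun x : State d => incOff s (inner ℝ w x) (inner ℝ u x) := by
  unfold incOff
  exact Measurable.ite (measurableSet_lt (by fun_prop) measurable_const) (by fun_prop)
    measurable_const

/-- The centered Gaussian is invariant under x ↦ -x, so both increments of
`min_sq_le_relu_increments` have the same mean. This accounts for the factor 1/8 in `smallBall`. -/
lemma two_smallBall_le {s : ℝ} (hs : 0 ≤ s) (w u : State d) (hu : ‖u‖ = 1) :
    2 * smallBall ≤ ∫ x, incOn s (inner ℝ w x) (inner ℝ u x) ∂(stdGaussian (State d)) +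
      ∫ x, incOff s (inner ℝ w x) (inner ℝ u x) ∂(stdGaussian (State d)) := by
  set γ := stdGaussian (State d)
  have hOn : Integrable (fun x : State d => incOn s (inner ℝ w x) (inner ℝ u x)) γ :=
    integrable_of_mem_unit (measurable_incOn s w u) (fun _ => incOn_nonneg _ _ _)
      fun _ => incOn_le_one _ _ _
  have hOff : Integrable (fun x : State d => incOff s (inner ℝ w x) (inner ℝ u x)) γ :=
    integrable_of_mem_unit (measurable_incOff s w u) (fun _ => incOff_nonneg _ _ _)
      fun _ => incOff_le_one _ _ _
  rw [← integral_add hOn hOff]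
  set h : State d → ℝ := fun x =>
    min ((max (s * inner ℝ w x + inner ℝ u x) 0 - max (s * inner ℝ w x) 0) ^ 2) 1 with hh
  have hhm : Measurable h := by fun_prop
  have hhi : Integrable h γ := integrable_of_mem_unit hhm (fun x => by positivity)
    fun x => min_le_right _ _
  have hhi' : Integrable (fun x => h (-x)) γ := integrable_of_mem_unit (by fun_prop)
    (fun x => by positivity) fun x => min_le_right _ _
  have e : ∫ x, (incOn s (inner ℝ w x) (inner ℝ u x) + incOff s (inner ℝ w x) (inner ℝ u x)) ∂γ
      = ∫ x, h x ∂γ := integral_congr_ae (Filter.Eventually.of_forall fun x =>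
    incOn_add_incOff hs _ _)
  rw [e]
  have h8 : 8 * smallBall = ∫ x, min ((inner ℝ u x) ^ 2) 1 ∂γ := by
    rw [integral_inner_stdGaussian u hu (fun y => min (y ^ 2) 1) (by fun_prop), smallBall]
    ring
  have hle : ∫ x, min ((inner ℝ u x) ^ 2) 1 ∂γ ≤ ∫ x, (2 * h x + 2 * h (-x)) ∂γ := by
    refine integral_mono (integrable_of_mem_unit (by fun_prop) (fun x => by positivity)
      fun x => min_le_right _ _) ((hhi.const_mul 2).add (hhi'.const_mul 2)) fun x => ?_
    simp only [hh, inner_neg_right]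
    exact min_sq_le_relu_increments
  rw [integral_add (hhi.const_mul 2) (hhi'.const_mul 2), integral_const_mul, integral_const_mul,
    integral_stdGaussian_neg h] at hle
  linarith

/-- The two means sum to at least 2·`smallBall`. If the active one is too small at scale 0, the
intermediate value theorem gives a scale where it equals `smallBall`, and the inactive one has the
rest. -/
lemma exists_scale (w u : State d) (hu : ‖u‖ = 1) :
    ∃ s : ℝ, 0 ≤ s ∧
      smallBall ≤ ∫ x, incOn s (inner ℝ w x) (inner ℝ u x) ∂(stdGaussian (State d)) ∧
      (s = 0 ∨
        smallBall ≤ ∫ x, incOff s (inner ℝ w x) (inner ℝ u x) ∂(stdGaussian (State d))) := by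
  set γ := stdGaussian (State d)
  set p : ℝ → ℝ := fun s => ∫ x, incOn s (inner ℝ w x) (inner ℝ u x) ∂γ with hp
  set q : ℝ → ℝ := fun s => ∫ x, incOff s (inner ℝ w x) (inner ℝ u x) ∂γ with hq
  have hpq : ∀ s, 0 ≤ s → 2 * smallBall ≤ p s + q s := fun s hs => two_smallBall_le hs w u hu
  by_cases h0 : smallBall ≤ p 0
  · exact ⟨0, le_rfl, h0, Or.inl rfl⟩
  have hpc : Continuous p := by
    refine continuous_of_dominated (bound := fun _ => 1)
      (fun s => (measurable_incOn s w u).aestronglyMeasurable)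
      (fun s => Filter.Eventually.of_forall fun x => ?_) (integrable_const _)
      (Filter.Eventually.of_forall fun x => continuous_incOn _ _)
    rw [Real.norm_eq_abs, abs_of_nonneg (incOn_nonneg _ _ _)]
    exact incOn_le_one _ _ _
  -- Where a < 0, the number sa + b is eventually nonpositive, so the inactive increment vanishes at
  -- large scales and the active mean has to exceed `smallBall` there.
  have hqt : Filter.Tendsto (fun n : ℕ => q n) Filter.atTop (nhds 0) := by
    have : (0 : ℝ) = ∫ _, (0 : ℝ) ∂γ := by simp
    rw [this]
    refine tendsto_integral_of_dominated_convergence (fun _ => 1)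
      (fun n => (measurable_incOff n w u).aestronglyMeasurable) (integrable_const _)
      (fun n => Filter.Eventually.of_forall fun x => ?_)
      (Filter.Eventually.of_forall fun x => ?_)
    · rw [Real.norm_eq_abs, abs_of_nonneg (incOff_nonneg _ _ _)]
      exact incOff_le_one _ _ _
    · refine tendsto_const_nhds.congr' ?_
      rcases lt_or_ge (inner ℝ w x : ℝ) 0 with ha | ha
      · obtain ⟨N, hN⟩ := exists_nat_ge ((inner ℝ u x : ℝ) / (-(inner ℝ w x)))
        filter_upwards [Filter.eventually_ge_atTop N] with n hn
        have hn' : (N : ℝ) ≤ n := by exact_mod_cast hn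
        have h1 : (inner ℝ u x : ℝ) ≤ n * (-(inner ℝ w x)) := by
          rw [← div_le_iff₀ (by linarith)]
          exact hN.trans hn'
        rw [incOff, if_pos ha, max_eq_right (by linarith)]
        simp
      · refine Filter.Eventually.of_forall fun n => ?_
        simp only [incOff, if_neg ha.not_gt]
  obtain ⟨N, hN⟩ := (hqt.eventually_le_const smallBall_pos).exists
  have hN0 : (0 : ℝ) ≤ N := Nat.cast_nonneg N
  have hpN : smallBall ≤ p N := by linarith [hpq N hN0]
  obtain ⟨s, hs, hps⟩ := intermediate_value_Icc hN0 hpc.continuousOn ⟨(not_le.1 h0).le, hpN⟩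
  refine ⟨s, hs.1, hps.ge, Or.inr ?_⟩
  have := hpq s hs.1
  rw [hps] at this
  change smallBall ≤ q s
  linarith

/-- For each direction `u` two bounded functions of conditional mean at least `smallBall` suffice
to bound from below, at all scales `s ≥ 0`, the squared ReLU increments. -/
theorem exists_relu_minorants (w u : State d) (hu : ‖u‖ = 1) :
    ∃ Φ : Bool → State d → ℝ, (∀ b, Measurable (Φ b)) ∧ (∀ b x, 0 ≤ Φ b x) ∧
      (∀ b x, Φ b x ≤ 1) ∧ (∀ b, smallBall ≤ ∫ x, Φ b x ∂(stdGaussian (State d))) ∧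
      ∀ s : ℝ, 0 ≤ s → ∃ b, ∀ x : State d, Φ b x ≤
        (max (s * inner ℝ w x + inner ℝ u x) 0 - max (s * inner ℝ w x) 0) ^ 2 := by
  -- The active increment grows with the scale and the inactive one decreases. Frozen at the
  -- critical scale r, the former minorizes for s ≥ r and the latter for s ≤ r; if r = 0, the former
  -- alone suffices.
  obtain ⟨r, hr0, hon, hoff⟩ := exists_scale w u hu
  have key1 : ∀ s : ℝ, r ≤ s → ∀ x : State d, incOn r (inner ℝ w x) (inner ℝ u x) ≤
      (max (s * inner ℝ w x + inner ℝ u x) 0 - max (s * inner ℝ w x) 0) ^ 2 := by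
    intro s hs x
    refine ((incOn_mono hr0 hs _ _).trans ?_).trans (min_le_left _ 1)
    rw [← incOn_add_incOff (hr0.trans hs)]
    linarith [incOff_nonneg s (inner ℝ w x) (inner ℝ u x)]
  rcases hoff with h0 | hoff
  · refine ⟨fun _ x => incOn r (inner ℝ w x) (inner ℝ u x), fun _ => measurable_incOn r w u,
      fun _ _ => incOn_nonneg _ _ _, fun _ _ => incOn_le_one _ _ _, fun _ => hon, fun s hs =>
      ⟨true, fun x => key1 s (h0 ▸ hs) x⟩⟩
  · refine ⟨fun b x => bif b then incOn r (inner ℝ w x) (inner ℝ u x)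
      else incOff r (inner ℝ w x) (inner ℝ u x), ?_, ?_, ?_, ?_, ?_⟩
    · rintro (_ | _)
      · exact measurable_incOff r w u
      · exact measurable_incOn r w u
    · rintro (_ | _) x
      · exact incOff_nonneg _ _ _
      · exact incOn_nonneg _ _ _
    · rintro (_ | _) x
      · exact incOff_le_one _ _ _
      · exact incOn_le_one _ _ _
    · rintro (_ | _)
      · exact hoff
      · exact hon
    · intro s hs
      rcases le_total r s with h | h
      · exact ⟨true, fun x => key1 s h x⟩
      · refine ⟨false, fun x => ?_⟩
        refine ((incOff_anti h _ _).trans ?_).trans (min_le_left _ 1)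
        rw [← incOn_add_incOff hs]
        linarith [incOn_nonneg s (inner ℝ w x) (inner ℝ u x)]

end Dichotomy

/-! ### A net of directions and the passage to all parameters -/

section Net

variable {d : ℕ}

/-- Cut the cube into cells of side 1/M and keep one unit vector from each cell that meets the
sphere. For the other cells `Function.invFun` returns an arbitrary unit vector. -/
theorem exists_sphere_net (hd : 0 < d) {M : ℕ} (hM : 0 < M) :
    ∃ r : (Fin d → Fin (2 * M + 1)) → State d, (∀ c, ‖r c‖ = 1) ∧
      ∀ u : State d, ‖u‖ = 1 → ∃ c, ‖u - r c‖ ^ 2 ≤ d / (M : ℝ) ^ 2 := by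
  classical
  have hM' : (0 : ℝ) < M := by exact_mod_cast hM
  have hcoord : ∀ u : State d, ‖u‖ = 1 → ∀ k, |u k| ≤ 1 := fun u hu k => by
    rw [← hu]; exact PiLp.norm_apply_le u k
  have hlt : ∀ u : State d, ‖u‖ = 1 → ∀ k, ⌊(u k + 1) * M⌋₊ < 2 * M + 1 := by
    intro u hu k
    have h1 := abs_le.1 (hcoord u hu k)
    rw [Nat.floor_lt (by nlinarith)]
    push_cast
    nlinarith
  set cell : {u : State d // ‖u‖ = 1} → (Fin d → Fin (2 * M + 1)) := fun u k =>
    ⟨⌊(u.1 k + 1) * M⌋₊, hlt u.1 u.2 k⟩ with hcell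
  have hne : Nonempty {u : State d // ‖u‖ = 1} := ⟨⟨EuclideanSpace.single ⟨0, hd⟩ 1, by simp⟩⟩
  refine ⟨fun c => (Function.invFun cell c).1, fun c => (Function.invFun cell c).2, fun u hu => ?_⟩
  refine ⟨cell ⟨u, hu⟩, ?_⟩
  obtain ⟨v, hv, hvc⟩ : ∃ v : {u : State d // ‖u‖ = 1},
      Function.invFun cell (cell ⟨u, hu⟩) = v ∧ cell v = cell ⟨u, hu⟩ :=
    ⟨_, rfl, Function.invFun_eq ⟨_, rfl⟩⟩
  simp only [hv]
  rw [EuclideanSpace.norm_sq_eq]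
  have hk : ∀ k, ‖(u - v.1) k‖ ^ 2 ≤ 1 / (M : ℝ) ^ 2 := by
    intro k
    have h1 : ⌊(v.1 k + 1) * M⌋₊ = ⌊(u k + 1) * M⌋₊ := congrArg Fin.val (congrFun hvc k)
    have hu0 : 0 ≤ (u k + 1) * M := by nlinarith [abs_le.1 (hcoord u hu k)]
    have hv0 : 0 ≤ (v.1 k + 1) * M := by nlinarith [abs_le.1 (hcoord v.1 v.2 k)]
    have a1 := Nat.floor_le hu0
    have a2 := Nat.lt_floor_add_one ((u k + 1) * (M : ℝ))
    have b1 := Nat.floor_le hv0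
    have b2 := Nat.lt_floor_add_one ((v.1 k + 1) * (M : ℝ))
    rw [h1] at b1 b2
    have h2 : |(u k - v.1 k) * M| ≤ 1 := by rw [abs_le]; constructor <;> nlinarith
    have h3 : ((u k - v.1 k) * M) ^ 2 ≤ 1 := by rw [sq_le_one_iff_abs_le_one]; exact h2
    rw [le_div_iff₀ (by positivity), Real.norm_eq_abs, sq_abs, ← mul_pow]
    simpa using h3
  calc ∑ k, ‖(u - v.1) k‖ ^ 2 ≤ ∑ _k : Fin d, 1 / (M : ℝ) ^ 2 := Finset.sum_le_sum fun k _ => hk k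
    _ = d / (M : ℝ) ^ 2 := by simp; ring

/-- With θ = w + tu, positive homogeneity writes the increment as t times an increment in direction
u at scale 1/t. Replacing u by a net point costs at most |⟨u - r c, x⟩|, as ReLU is 1-Lipschitz. -/
theorem relu_row_lower_bound {ι : Type*} (w : State d) (r : ι → State d)
    (Φ : ι → Bool → State d → ℝ)
    (hΦ : ∀ c, ∀ s : ℝ, 0 ≤ s → ∃ b, ∀ x : State d, Φ c b x ≤
      (max (s * inner ℝ w x + inner ℝ (r c) x) 0 - max (s * inner ℝ w x) 0) ^ 2)
    {e B : ℝ} (hr : ∀ u : State d, ‖u‖ = 1 → ∃ c, ‖u - r c‖ ^ 2 ≤ e) (I : Finset ℕ)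
    (x : ℕ → State d) (hB : ∀ c b, B ≤ ∑ i ∈ I, Φ c b (x i)) (θ : State d) :
    (B / 2 - e * ∑ i ∈ I, ‖x i‖ ^ 2) * ‖θ - w‖ ^ 2 ≤
      ∑ i ∈ I, (max (inner ℝ θ (x i)) 0 - max (inner ℝ w (x i)) 0) ^ 2 := by
  by_cases hθ : θ = w
  · simp [hθ]
  set t := ‖θ - w‖ with ht
  have htpos : 0 < t := norm_pos_iff.2 (sub_ne_zero.2 hθ)
  set u : State d := t⁻¹ • (θ - w) with hu
  have hu1 : ‖u‖ = 1 := by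
    rw [hu, norm_smul, norm_inv, Real.norm_eq_abs, abs_of_pos htpos, inv_mul_cancel₀ htpos.ne']
  obtain ⟨c, hc⟩ := hr u hu1
  obtain ⟨b, hb⟩ := hΦ c t⁻¹ (by positivity)
  have hpoint : ∀ y : State d, (Φ c b y / 2 - e * ‖y‖ ^ 2) * t ^ 2 ≤
      (max (inner ℝ θ y) 0 - max (inner ℝ w y) 0) ^ 2 := by
    intro y
    set a : ℝ := inner ℝ w y with ha
    set p := max (t⁻¹ * a + inner ℝ u y) 0 - max (t⁻¹ * a) 0 with hp
    set q := max (t⁻¹ * a + inner ℝ (r c) y) 0 - max (t⁻¹ * a) 0 with hq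
    have h1 : max (inner ℝ θ y) 0 - max a 0 = t * p := by
      have e1 : t * (t⁻¹ * a + inner ℝ u y) = inner ℝ θ y := by
        rw [hu, real_inner_smul_left, inner_sub_left]
        field_simp
        rw [ha]
        ring
      have e2 : t * (t⁻¹ * a) = a := by field_simp
      rw [hp, mul_sub, mul_max_of_nonneg _ _ htpos.le, mul_max_of_nonneg _ _ htpos.le, e1, e2,
        mul_zero]
    have h2 : |q - p| ≤ |inner ℝ (u - r c) y| := by
      have : q - p = max (t⁻¹ * a + inner ℝ (r c) y) 0 - max (t⁻¹ * a + inner ℝ u y) 0 := by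
        rw [hp, hq]; ring
      rw [this, inner_sub_left]
      refine (abs_max_sub_max_le_abs _ _ _).trans ?_
      rw [add_sub_add_left_eq_sub, abs_sub_comm]
    have h3 : (q - p) ^ 2 ≤ e * ‖y‖ ^ 2 := by
      calc (q - p) ^ 2 ≤ (inner ℝ (u - r c) y) ^ 2 := sq_le_sq.2 h2
        _ ≤ (‖u - r c‖ * ‖y‖) ^ 2 := sq_le_sq.2 (by
            rw [abs_of_nonneg (by positivity : 0 ≤ ‖u - r c‖ * ‖y‖)]
            exact abs_real_inner_le_norm _ _)
        _ = ‖u - r c‖ ^ 2 * ‖y‖ ^ 2 := by ring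
        _ ≤ _ := by gcongr
    have h4 : Φ c b y ≤ q ^ 2 := hb y
    rw [h1, mul_pow, mul_comm]
    gcongr
    -- This uses p² ≥ q²/2 - (q - p)².
    nlinarith [sq_nonneg (q - 2 * p)]
  calc (B / 2 - e * ∑ i ∈ I, ‖x i‖ ^ 2) * t ^ 2
      ≤ ((∑ i ∈ I, Φ c b (x i)) / 2 - e * ∑ i ∈ I, ‖x i‖ ^ 2) * t ^ 2 := by
        gcongr; exact hB c b
    _ = ∑ i ∈ I, (Φ c b (x i) / 2 - e * ‖x i‖ ^ 2) * t ^ 2 := by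
        rw [← Finset.sum_mul, Finset.sum_sub_distrib, Finset.sum_div, Finset.mul_sum]
    _ ≤ _ := Finset.sum_le_sum fun i _ => hpoint _

end Net

/-! ### Deterministic analysis of projected pseudogradient descent -/

section Descent

attribute [local instance] Matrix.frobeniusNormedSpace

variable {d : ℕ}

/-- The Frobenius inner product of two matrices. -/
def frobInner (A B : Mat d) : ℝ := ∑ j, ∑ k, A j k * B j k

lemma frobenius_norm_sq (A : Mat d) : ‖A‖ ^ 2 = ∑ j, ∑ k, A j k ^ 2 := by
  rw [Matrix.frobenius_norm_def, ← Real.sqrt_eq_rpow, Real.sq_sqrt (by positivity)]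
  simp

lemma norm_sub_smul_sq (A B : Mat d) (t : ℝ) :
    ‖A - t • B‖ ^ 2 = ‖A‖ ^ 2 - 2 * t * frobInner A B + t ^ 2 * ‖B‖ ^ 2 := by
  simp only [frobenius_norm_sq, frobInner, Finset.mul_sum, ← Finset.sum_sub_distrib,
    ← Finset.sum_add_distrib]
  refine Finset.sum_congr rfl fun j _ => Finset.sum_congr rfl fun k _ => ?_
  simp
  ring

lemma frobInner_sub_left (A B C : Mat d) :
    frobInner (A - B) C = frobInner A C - frobInner B C := by
  simp only [frobInner, ← Finset.sum_sub_distrib]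
  refine Finset.sum_congr rfl fun j _ => Finset.sum_congr rfl fun k _ => ?_
  simp
  ring

lemma frobInner_comm (A B : Mat d) : frobInner A B = frobInner B A := by
  simp only [frobInner, mul_comm]

/-- `proj` is a choice and has its defining property only once a minimizer is exhibited: A itself
inside the ball, its radial rescaling outside. -/
lemma exists_isProj_closedBall {W : ℝ} (hW : 0 ≤ W) (A : Mat d) :
    ∃ P, IsProj {Θ : Mat d | ‖Θ‖ ≤ W} A P := by
  by_cases h : ‖A‖ ≤ W
  · exact ⟨A, h, fun Q _ => by simp⟩
  · have hA : W < ‖A‖ := not_le.1 h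
    have hpos : 0 < ‖A‖ := hW.trans_lt hA
    refine ⟨(W / ‖A‖) • A, ?_, fun Q hQ => ?_⟩
    · change ‖(W / ‖A‖) • A‖ ≤ W
      rw [norm_smul, Real.norm_eq_abs, abs_of_nonneg (by positivity), div_mul_cancel₀ _ hpos.ne']
    · have e : A - (W / ‖A‖) • A = (1 - W / ‖A‖) • A := by rw [sub_smul, one_smul]
      have h1 : W / ‖A‖ ≤ 1 := (div_le_one hpos).2 hA.le
      rw [e, norm_smul, Real.norm_eq_abs, abs_of_nonneg (by linarith), sub_mul, one_mul,
        div_mul_cancel₀ _ hpos.ne']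
      have hQ' : ‖Q‖ ≤ W := hQ
      linarith [norm_sub_norm_le A Q]

/-- Minimality along the segment from P to Q gives the obtuse angle condition ⟨A - P, Q - P⟩ ≤ 0,
and expanding the square concludes. -/
lemma norm_proj_sub_sq_le {W : ℝ} (A : Mat d) {Q : Mat d} (hQ : ‖Q‖ ≤ W) :
    ‖proj {Θ : Mat d | ‖Θ‖ ≤ W} A‖ ≤ W ∧
      ‖proj {Θ : Mat d | ‖Θ‖ ≤ W} A - Q‖ ^ 2 ≤ ‖A - Q‖ ^ 2 := by
  have hW : 0 ≤ W := (norm_nonneg Q).trans hQ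
  have hproj : IsProj {Θ : Mat d | ‖Θ‖ ≤ W} A (proj {Θ : Mat d | ‖Θ‖ ≤ W} A) :=
    Classical.epsilon_spec (exists_isProj_closedBall hW A)
  set P := proj {Θ : Mat d | ‖Θ‖ ≤ W} A
  obtain ⟨hP, hmin⟩ := hproj
  replace hP : ‖P‖ ≤ W := hP
  refine ⟨hP, ?_⟩
  have hseg : ∀ t : ℝ, 0 < t → t ≤ 1 →
      2 * frobInner (A - P) (Q - P) ≤ t * ‖Q - P‖ ^ 2 := by
    intro t ht0 ht1
    have hmem : ‖P + t • (Q - P)‖ ≤ W := by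
      have e : P + t • (Q - P) = (1 - t) • P + t • Q := by
        rw [smul_sub, sub_smul, one_smul]; abel
      rw [e]
      calc ‖(1 - t) • P + t • Q‖ ≤ ‖(1 - t) • P‖ + ‖t • Q‖ := norm_add_le _ _
        _ = (1 - t) * ‖P‖ + t * ‖Q‖ := by
          rw [norm_smul, norm_smul, Real.norm_eq_abs, Real.norm_eq_abs,
            abs_of_nonneg (by linarith), abs_of_pos ht0]
        _ ≤ W := by nlinarith
    have h1 := hmin _ hmem
    have h2 : ‖A - P‖ ^ 2 ≤ ‖A - P - t • (Q - P)‖ ^ 2 := by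
      rw [sub_sub]
      exact pow_le_pow_left₀ (norm_nonneg _) h1 2
    rw [norm_sub_smul_sq] at h2
    have h3 : t * (2 * frobInner (A - P) (Q - P)) ≤ t * (t * ‖Q - P‖ ^ 2) := by nlinarith
    exact le_of_mul_le_mul_left h3 ht0
  have hinner : frobInner (A - P) (Q - P) ≤ 0 := by
    by_contra hneg
    rw [not_le] at hneg
    set a := frobInner (A - P) (Q - P)
    set b := ‖Q - P‖ ^ 2
    have hb : 0 ≤ b := sq_nonneg _
    -- In place of a limit t → 0: this t satisfies tb ≤ a, against 2a ≤ tb and a > 0.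
    have h1 := hseg (min 1 (a / (b + 1))) (by positivity) (min_le_left _ _)
    have h2 : min 1 (a / (b + 1)) * b ≤ a / (b + 1) * b :=
      mul_le_mul_of_nonneg_right (min_le_right _ _) hb
    have h3 : a / (b + 1) * b ≤ a := by
      rw [div_mul_eq_mul_div, div_le_iff₀ (by positivity)]
      nlinarith
    linarith
  have e : A - Q = (A - P) - (1 : ℝ) • (Q - P) := by rw [one_smul]; abel
  rw [e, norm_sub_smul_sq, norm_sub_rev P Q]
  nlinarith [sq_nonneg ‖A - P‖]

/-- The `j`-th row of a matrix, as a vector of the state space. -/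
noncomputable def row (Θ : Mat d) (j : Fin d) : State d := WithLp.toLp 2 (Θ j)

lemma inner_row (Θ : Mat d) (j : Fin d) (x : State d) :
    inner ℝ (row Θ j) x = ∑ k, Θ j k * x k := by
  simp [row, PiLp.inner_apply, mul_comm]

lemma glm_relu_apply (Θ : Mat d) (x : State d) (j : Fin d) :
    glm relu Θ x j = max (inner ℝ (row Θ j) x) 0 := by
  simp only [glm, relu, inner_row]
  rfl

lemma norm_sub_sq_eq_sum_rows (Θ Θ' : Mat d) :
    ‖Θ - Θ'‖ ^ 2 = ∑ j, ‖row Θ j - row Θ' j‖ ^ 2 := by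
  rw [frobenius_norm_sq]
  refine Finset.sum_congr rfl fun j _ => ?_
  rw [EuclideanSpace.norm_sq_eq]
  simp [row]

/-- The empirical squared prediction discrepancy between two parameters. -/
noncomputable def predError (n : ℕ) (x : ℕ → State d) (Θ Θ' : Mat d) : ℝ :=
  1 / (n : ℝ) * ∑ i ∈ Finset.Icc 1 n, ∑ j, (glm relu Θ (x i) j - glm relu Θ' (x i) j) ^ 2

/-- The difference of the pseudogradients at two parameters. -/
noncomputable def signalGrad (n : ℕ) (x : ℕ → State d) (Θ Θ' : Mat d) : Mat d :=
  Matrix.of fun j k => 1 / (n : ℝ) *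
    ∑ i ∈ Finset.Icc 1 n, (glm relu Θ (x i) j - glm relu Θ' (x i) j) * x i k

/-- The negative of the pseudogradient at the true parameter. -/
noncomputable def noiseGrad (n : ℕ) (x : ℕ → State d) (Θ' : Mat d) : Mat d :=
  Matrix.of fun j k => 1 / (n : ℝ) *
    ∑ i ∈ Finset.Icc 1 n, (x (i + 1) j - glm relu Θ' (x i) j) * x i k

lemma pseudograd_eq (n : ℕ) (x : ℕ → State d) (Θ Θ' : Mat d) :
    pseudograd relu n x Θ = signalGrad n x Θ Θ' - noiseGrad n x Θ' := by
  ext j k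
  simp only [pseudograd, signalGrad, noiseGrad, Matrix.smul_apply, Matrix.sum_apply,
    Matrix.sub_apply, Matrix.of_apply, Matrix.vecMulVec_apply, smul_eq_mul, ← mul_sub,
    ← Finset.sum_sub_distrib]
  congr 1
  refine Finset.sum_congr rfl fun i _ => ?_
  simp
  ring

/-- Pointwise (σ(a) - σ(b))² ≤ (σ(a) - σ(b))(a - b), since ReLU is monotone and 1-Lipschitz. No
derivative of the link is needed. -/
lemma predError_le_frobInner (n : ℕ) (x : ℕ → State d) (Θ Θ' : Mat d) :
    predError n x Θ Θ' ≤ frobInner (signalGrad n x Θ Θ') (Θ - Θ') := by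
  have e : frobInner (signalGrad n x Θ Θ') (Θ - Θ') = 1 / (n : ℝ) *
      ∑ i ∈ Finset.Icc 1 n, ∑ j, (glm relu Θ (x i) j - glm relu Θ' (x i) j) *
        (inner ℝ (row Θ j) (x i) - inner ℝ (row Θ' j) (x i)) := by
    rw [Finset.sum_comm]
    simp only [frobInner, signalGrad, Matrix.of_apply, Finset.mul_sum]
    refine Finset.sum_congr rfl fun j _ => ?_
    simp only [Finset.sum_mul]
    rw [Finset.sum_comm]
    refine Finset.sum_congr rfl fun i _ => ?_
    rw [inner_row, inner_row, ← Finset.sum_sub_distrib, Finset.mul_sum, Finset.mul_sum]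
    refine Finset.sum_congr rfl fun k _ => ?_
    simp
    ring
  rw [e, predError]
  refine mul_le_mul_of_nonneg_left ?_ (by positivity)
  refine Finset.sum_le_sum fun i _ => Finset.sum_le_sum fun j _ => ?_
  rw [glm_relu_apply, glm_relu_apply]
  set a : ℝ := inner ℝ (row Θ j) (x i)
  set b : ℝ := inner ℝ (row Θ' j) (x i)
  rcases le_total 0 a with ha | ha <;> rcases le_total 0 b with hb | hb
  · rw [max_eq_left ha, max_eq_left hb, sq]
  · rw [max_eq_left ha, max_eq_right hb]; nlinarith
  · rw [max_eq_right ha, max_eq_left hb]; nlinarith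
  · rw [max_eq_right ha, max_eq_right hb]; simp

lemma norm_signalGrad_sq_le (n : ℕ) (x : ℕ → State d) (Θ Θ' : Mat d) :
    ‖signalGrad n x Θ Θ'‖ ^ 2 ≤
      (1 / (n : ℝ) * ∑ i ∈ Finset.Icc 1 n, ‖x i‖ ^ 2) * predError n x Θ Θ' := by
  rw [frobenius_norm_sq, predError]
  simp only [signalGrad, Matrix.of_apply, mul_pow]
  have h : ∀ j k, (∑ i ∈ Finset.Icc 1 n, (glm relu Θ (x i) j - glm relu Θ' (x i) j) * x i k) ^ 2 ≤
      (∑ i ∈ Finset.Icc 1 n, (glm relu Θ (x i) j - glm relu Θ' (x i) j) ^ 2) *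
      ∑ i ∈ Finset.Icc 1 n, (x i k) ^ 2 := fun j k => Finset.sum_mul_sq_le_sq_mul_sq _ _ _
  calc ∑ j, ∑ k, (1 / (n : ℝ)) ^ 2 *
        (∑ i ∈ Finset.Icc 1 n, (glm relu Θ (x i) j - glm relu Θ' (x i) j) * x i k) ^ 2
      ≤ ∑ j, ∑ k, (1 / (n : ℝ)) ^ 2 *
        ((∑ i ∈ Finset.Icc 1 n, (glm relu Θ (x i) j - glm relu Θ' (x i) j) ^ 2) *
          ∑ i ∈ Finset.Icc 1 n, (x i k) ^ 2) := by
        refine Finset.sum_le_sum fun j _ => Finset.sum_le_sum fun k _ => ?_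
        exact mul_le_mul_of_nonneg_left (h j k) (by positivity)
    _ = _ := by
        have e : ∑ i ∈ Finset.Icc 1 n, ‖x i‖ ^ 2 = ∑ k, ∑ i ∈ Finset.Icc 1 n, (x i k) ^ 2 := by
          rw [Finset.sum_comm]
          refine Finset.sum_congr rfl fun i _ => ?_
          rw [EuclideanSpace.norm_sq_eq]; simp
        simp only [← Finset.mul_sum, ← Finset.sum_mul]
        rw [e, Finset.sum_comm (s := Finset.univ) (t := Finset.Icc 1 n)
          (f := fun j i => (glm relu Θ (x i) j - glm relu Θ' (x i) j) ^ 2)]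
        ring

lemma predError_nonneg (n : ℕ) (x : ℕ → State d) (Θ Θ' : Mat d) : 0 ≤ predError n x Θ Θ' := by
  unfold predError; positivity

lemma two_frobInner_le (A B : Mat d) {a : ℝ} (ha : 0 < a) :
    2 * frobInner A B ≤ a * ‖B‖ ^ 2 + a⁻¹ * ‖A‖ ^ 2 := by
  have h := norm_sub_smul_sq A B a
  have h0 := sq_nonneg ‖A - a • B‖
  rw [h] at h0
  have h1 := mul_nonneg (inv_nonneg.2 ha.le) h0
  have e : a⁻¹ * (‖A‖ ^ 2 - 2 * a * frobInner A B + a ^ 2 * ‖B‖ ^ 2) =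
      a⁻¹ * ‖A‖ ^ 2 - 2 * frobInner A B + a * ‖B‖ ^ 2 := by
    field_simp
  rw [e] at h1
  linarith

lemma norm_sub_sq_le_two (A B : Mat d) : ‖A - B‖ ^ 2 ≤ 2 * ‖A‖ ^ 2 + 2 * ‖B‖ ^ 2 := by
  have h := norm_sub_le A B
  nlinarith [norm_nonneg (A - B), sq_nonneg (‖A‖ - ‖B‖)]

/-- In the expanded square, ηS ≤ 1/2 lets half of the gain 2ηE pay for the squared signal gradient.
Young's inequality with weight α/2 lets the noise cross term consume half of the remaining
curvature. -/
lemma descent_step {n : ℕ} {x : ℕ → State d} {Θ' : Mat d} {W η α S : ℝ} (hΘ' : ‖Θ'‖ ≤ W)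
    (hη : 0 < η) (hα : 0 < α) (hS : 1 / (n : ℝ) * ∑ i ∈ Finset.Icc 1 n, ‖x i‖ ^ 2 ≤ S)
    (hηS : η * S ≤ 1 / 2) {Θ : Mat d} (hcurv : α * ‖Θ - Θ'‖ ^ 2 ≤ predError n x Θ Θ') :
    ‖proj {Θ : Mat d | ‖Θ‖ ≤ W} (Θ - η • pseudograd relu n x Θ) - Θ'‖ ^ 2 ≤
      (1 - η * α / 2) * ‖Θ - Θ'‖ ^ 2 + (2 * η / α + 2 * η ^ 2) * ‖noiseGrad n x Θ'‖ ^ 2 := by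
  refine (norm_proj_sub_sq_le _ hΘ').2.trans ?_
  set G := pseudograd relu n x Θ with hG
  set G₀ := signalGrad n x Θ Θ' with hG₀
  set N := noiseGrad n x Θ' with hN
  set E := predError n x Θ Θ' with hE
  have hGe : G = G₀ - N := pseudograd_eq n x Θ Θ'
  have e : Θ - η • G - Θ' = (Θ - Θ') - η • G := by abel
  rw [e, norm_sub_smul_sq, frobInner_comm, hGe, frobInner_sub_left]
  have h1 : E ≤ frobInner G₀ (Θ - Θ') := predError_le_frobInner n x Θ Θ'
  have h2 := two_frobInner_le N (Θ - Θ') (half_pos hα)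
  have h3 := norm_sub_sq_le_two G₀ N
  have hE0 : 0 ≤ E := predError_nonneg n x Θ Θ'
  have h4 : ‖G₀‖ ^ 2 ≤ S * E := (norm_signalGrad_sq_le n x Θ Θ').trans
    (mul_le_mul_of_nonneg_right hS hE0)
  have h5 : (α / 2)⁻¹ = 2 / α := by rw [inv_div]
  rw [h5] at h2
  have h6 : η ^ 2 * ‖G₀ - N‖ ^ 2 ≤ η * E + 2 * η ^ 2 * ‖N‖ ^ 2 := by
    calc η ^ 2 * ‖G₀ - N‖ ^ 2 ≤ η ^ 2 * (2 * ‖G₀‖ ^ 2 + 2 * ‖N‖ ^ 2) := by gcongr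
      _ ≤ η ^ 2 * (2 * (S * E) + 2 * ‖N‖ ^ 2) := by gcongr
      _ = 2 * (η * S) * (η * E) + 2 * η ^ 2 * ‖N‖ ^ 2 := by ring
      _ ≤ 1 * (η * E) + 2 * η ^ 2 * ‖N‖ ^ 2 := by gcongr; linarith
      _ = _ := by ring
  have h7 : η * (2 * frobInner N (Θ - Θ')) ≤ η * (α / 2 * ‖Θ - Θ'‖ ^ 2 + 2 / α * ‖N‖ ^ 2) := by
    gcongr
  have h8 : η * E ≤ η * frobInner G₀ (Θ - Θ') := by gcongr
  have h9 : η * (α * ‖Θ - Θ'‖ ^ 2) ≤ η * E := by gcongr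
  have e2 : (2 * η / α + 2 * η ^ 2) * ‖N‖ ^ 2 = η * (2 / α * ‖N‖ ^ 2) + 2 * η ^ 2 * ‖N‖ ^ 2 := by
    ring
  rw [e2]
  linarith

/-- Iterates the affine recursion of `descent_step`; its fixed point is at most 8/α² times the
squared noise, as ηα ≤ 1. -/
theorem iterate_error_le {n : ℕ} {x : ℕ → State d} {Θ' : Mat d} {W η α S : ℝ} (hΘ' : ‖Θ'‖ ≤ W)
    (hη : 0 < η) (hα : 0 < α) (hηα : η * α ≤ 1)
    (hS : 1 / (n : ℝ) * ∑ i ∈ Finset.Icc 1 n, ‖x i‖ ^ 2 ≤ S)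
    (hηS : η * S ≤ 1 / 2) (hcurv : ∀ Θ : Mat d, α * ‖Θ - Θ'‖ ^ 2 ≤ predError n x Θ Θ') (t : ℕ) :
    ‖iterate relu W (fun _ => η) n x t - Θ'‖ ^ 2 ≤
      Real.exp (-(η * α / 2 * t)) * W ^ 2 + 8 / α ^ 2 * ‖noiseGrad n x Θ'‖ ^ 2 := by
  set b := (2 * η / α + 2 * η ^ 2) * ‖noiseGrad n x Θ'‖ ^ 2 with hb
  set q := 1 - η * α / 2 with hq
  have hηα0 : 0 < η * α := mul_pos hη hα
  have hb8 : b ≤ (η * α / 2) * (8 / α ^ 2 * ‖noiseGrad n x Θ'‖ ^ 2) := by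
    have e : (η * α / 2) * (8 / α ^ 2 * ‖noiseGrad n x Θ'‖ ^ 2) =
        (4 * η / α) * ‖noiseGrad n x Θ'‖ ^ 2 := by field_simp; ring
    rw [e, hb]
    gcongr
    have h1 : η ^ 2 ≤ η / α := by
      rw [le_div_iff₀ hα]; nlinarith
    have e2 : 4 * η / α = 2 * η / α + 2 * (η / α) := by ring
    rw [e2]
    linarith
  have hrec : ‖iterate relu W (fun _ => η) n x t - Θ'‖ ^ 2 ≤
      q ^ t * W ^ 2 + 8 / α ^ 2 * ‖noiseGrad n x Θ'‖ ^ 2 := by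
    induction t with
    | zero =>
      have h : ‖(0 : Mat d) - Θ'‖ ≤ W := by rwa [zero_sub, norm_neg]
      have h2 := pow_le_pow_left₀ (norm_nonneg _) h 2
      have h3 : 0 ≤ 8 / α ^ 2 * ‖noiseGrad n x Θ'‖ ^ 2 := by positivity
      simp only [iterate, pow_zero, one_mul]
      linarith
    | succ t ih =>
      have hstep := descent_step hΘ' hη hα hS hηS (hcurv (iterate relu W (fun _ => η) n x t))
      simp only [iterate]
      rw [← hq, ← hb] at hstep
      refine hstep.trans ?_
      have hq0 : 0 ≤ q := by rw [hq]; linarith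
      have h1 := mul_le_mul_of_nonneg_left ih hq0
      rw [pow_succ q t]
      have h2 : q * (q ^ t * W ^ 2 + 8 / α ^ 2 * ‖noiseGrad n x Θ'‖ ^ 2) =
        q ^ t * q * W ^ 2 + 8 / α ^ 2 * ‖noiseGrad n x Θ'‖ ^ 2
          - (η * α / 2) * (8 / α ^ 2 * ‖noiseGrad n x Θ'‖ ^ 2) := by rw [hq]; ring
      linarith
  refine hrec.trans ?_
  gcongr
  have hq0 : 0 ≤ q := by rw [hq]; linarith
  have hqe : q ≤ Real.exp (-(η * α / 2)) := by
    have := Real.add_one_le_exp (-(η * α / 2))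
    rw [hq]; linarith
  calc q ^ t ≤ Real.exp (-(η * α / 2)) ^ t := pow_le_pow_left₀ hq0 hqe t
    _ = _ := by rw [← Real.exp_nat_mul]; congr 1; ring

lemma norm_lastIterate_le {n : ℕ} {x : ℕ → State d} {Θ' : Mat d} {W : ℝ} (hΘ' : ‖Θ'‖ ≤ W)
    (η : ℕ → ℝ) (m : ℕ) : ‖lastIterate relu W η n x m‖ ≤ W := by
  rw [lastIterate]
  cases m - 1 with
  | zero => simpa [iterate] using (norm_nonneg _).trans hΘ'
  | succ t => exact (norm_proj_sub_sq_le _ hΘ').1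

end Descent

/-! ### Deviation bounds for energy, noise and minorants -/

section Events

lemma measure_iUnion_le_card_mul {Ω : Type*} [MeasurableSpace Ω] {μ : Measure Ω} {ι : Type*} [Fintype ι] {E : ι → Set Ω} {p : ℝ}
    (h : ∀ i, μ (E i) ≤ ENNReal.ofReal p) :
    μ (⋃ i, E i) ≤ ENNReal.ofReal (Fintype.card ι * p) := by
  refine (measure_iUnion_fintype_le μ E).trans ((Finset.sum_le_sum fun i _ => h i).trans ?_)
  rw [Finset.sum_const, Finset.card_univ, nsmul_eq_mul, ENNReal.ofReal_mul (by positivity),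
    ENNReal.ofReal_natCast]

variable {d : ℕ}

lemma measurable_glm_relu (Θ : Mat d) : Measurable (glm relu Θ) := by
  have h : Measurable fun x : State d => (fun j => max (inner ℝ (row Θ j) x) 0 : Fin d → ℝ) := by
    fun_prop
  have e : glm relu Θ = fun x => WithLp.toLp 2 (fun j => max (inner ℝ (row Θ j) x) 0) := by
    funext x
    ext j
    exact glm_relu_apply Θ x j
  rw [e]
  fun_prop

/-- The weighted energy `x ↦ xᵀ K x` of a diagonal matrix `K`. -/
def energy (K : Mat d) (x : State d) : ℝ := ∑ j, K j j * x j ^ 2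

lemma one_le_diag {Θ K : Mat d} {ρ : ℝ} (h : IsLyapunovStable Θ K ρ) (j : Fin d) : 1 ≤ K j j := by
  have := h.one_le.diag_nonneg (i := j)
  simp at this
  linarith

lemma diag_le_trace {Θ K : Mat d} {ρ : ℝ} (h : IsLyapunovStable Θ K ρ) (j : Fin d) :
    K j j ≤ K.trace :=
  Finset.single_le_sum (f := fun j => K j j) (fun i _ => zero_le_one.trans (one_le_diag h i))
    (Finset.mem_univ j)

lemma card_le_trace {Θ K : Mat d} {ρ : ℝ} (h : IsLyapunovStable Θ K ρ) : (d : ℝ) ≤ K.trace := by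
  calc (d : ℝ) = ∑ _j : Fin d, (1 : ℝ) := by simp
    _ ≤ ∑ j, K j j := Finset.sum_le_sum fun j _ => one_le_diag h j
    _ = K.trace := rfl

lemma energy_nonneg {Θ K : Mat d} {ρ : ℝ} (h : IsLyapunovStable Θ K ρ) (x : State d) :
    0 ≤ energy K x :=
  Finset.sum_nonneg fun j _ => mul_nonneg (zero_le_one.trans (one_le_diag h j)) (sq_nonneg _)

lemma norm_sq_le_energy {Θ K : Mat d} {ρ : ℝ} (h : IsLyapunovStable Θ K ρ) (x : State d) :
    ‖x‖ ^ 2 ≤ energy K x := by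
  rw [EuclideanSpace.norm_sq_eq]
  refine Finset.sum_le_sum fun j _ => ?_
  rw [Real.norm_eq_abs, sq_abs]
  nlinarith [one_le_diag h j, sq_nonneg (x j)]

/-- For diagonal K the energy is a weighted sum of squared coordinates, which ReLU can only
decrease; the Lyapunov inequality then applies to Θx. -/
lemma energy_glm_le {Θ K : Mat d} {ρ : ℝ} (h : IsLyapunovStable Θ K ρ) (x : State d) :
    energy K (glm relu Θ x) ≤ ρ * energy K x := by
  have hdiag : ∀ v : Fin d → ℝ, dotProduct v (K.mulVec v) = ∑ j, K j j * v j ^ 2 := by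
    intro v
    simp only [dotProduct, Matrix.mulVec]
    refine Finset.sum_congr rfl fun j _ => ?_
    rw [Finset.sum_eq_single j (fun k _ hk => by rw [h.diag hk.symm, zero_mul]) (by simp)]
    ring
  have h1 := h.lyapunov.dotProduct_mulVec_nonneg x.ofLp
  rw [star_trivial, Matrix.sub_mulVec, dotProduct_sub, Matrix.smul_mulVec, dotProduct_smul,
    hdiag, smul_eq_mul, ← Matrix.mulVec_mulVec, ← Matrix.mulVec_mulVec, Matrix.mulVec_transpose,
    dotProduct_comm, ← Matrix.dotProduct_mulVec, dotProduct_comm, hdiag] at h1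
  refine le_trans ?_ (sub_nonneg.1 h1)
  refine Finset.sum_le_sum fun j _ => ?_
  refine mul_le_mul_of_nonneg_left ?_ (zero_le_one.trans (one_le_diag h j))
  rw [glm_relu_apply, inner_row]
  change max (Matrix.mulVec Θ x.ofLp j) 0 ^ 2 ≤ _
  rcases le_total 0 (Matrix.mulVec Θ x.ofLp j) with hj | hj
  · rw [max_eq_left hj]
  · rw [max_eq_right hj, zero_pow two_ne_zero]; exact sq_nonneg _

lemma lintegral_exp_affine_quadratic_le_one {c : ℝ} {t s : Fin d → ℝ} (ht0 : ∀ j, 0 ≤ t j)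
    (ht : ∀ j, t j ≤ 1 / 8) (hc : c + ∑ j, (3 / 2 * t j + 2 / 3 * s j ^ 2) ≤ 0) :
    ∫⁻ e, ENNReal.ofReal (Real.exp (c + ∑ j, (t j * e j ^ 2 + s j * e j)))
      ∂(stdGaussian (State d)) ≤ 1 := by
  simp_rw [Real.exp_add c, ENNReal.ofReal_mul (Real.exp_pos c).le]
  rw [lintegral_const_mul' _ _ ENNReal.ofReal_ne_top]
  refine (mul_le_mul_right (lintegral_exp_quadratic_stdGaussian t s ht0 ht) _).trans ?_
  rw [← ENNReal.ofReal_mul (Real.exp_pos c).le, ← Real.exp_add]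
  rw [← ENNReal.ofReal_one]
  exact ENNReal.ofReal_le_ofReal (Real.exp_le_one_iff.2 hc)

lemma sum_range_succ_eq_sum_Icc (h : ℕ → ℝ) (n : ℕ) :
    ∑ i ∈ Finset.range n, h (i + 1) = ∑ i ∈ Finset.Icc 1 n, h i := by
  induction n with
  | zero => simp
  | succ n ih => rw [Finset.sum_range_succ, ih, Finset.sum_Icc_succ_top (by omega)]

lemma sum_range_le_sum_Icc {h : ℕ → ℝ} (h0 : h 0 = 0) (hn : ∀ i, 0 ≤ h i) (n : ℕ) :
    ∑ i ∈ Finset.range n, h i ≤ ∑ i ∈ Finset.Icc 1 n, h i := by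
  have e := Finset.sum_range_succ h n
  rw [Finset.sum_range_succ', h0, add_zero, sum_range_succ_eq_sum_Icc] at e
  linarith [hn n]

variable {Ω : Type*} [MeasurableSpace Ω] {μ : Measure Ω} [IsProbabilityMeasure μ] {n : ℕ}
  {ε : ℕ → Ω → State d}

theorem energy_deviation (hd : 0 < d) (hm : ∀ i ≤ n, Measurable (ε i))
    (hind : iIndepFun (fun i : Fin (n + 1) => ε i) μ)
    (hlaw : ∀ i ≤ n, μ.map (ε i) = stdGaussian (State d)) {Θ K : Mat d} {ρ : ℝ}
    (h : IsLyapunovStable Θ K ρ) {p : ℝ} (hp : 0 < p) :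
    μ {ω | ¬ ∑ i ∈ Finset.Icc 1 n, energy K (trajectory (glm relu Θ) (fun i => ε i ω) i)
      ≤ 9 / 4 * (n * effRadius K ρ) + 12 * effRadius K ρ * Real.log (1 / p) / (1 - ρ)}
      ≤ ENNReal.ofReal p := by
  set R := effRadius K ρ with hR
  set f := glm relu Θ with hf
  have hfm : Measurable f := measurable_glm_relu Θ
  have hρ := h.rho_lt_one
  have hρ0 := h.rho_nonneg
  have h1ρ : 0 < 1 - ρ := by linarith
  have hd' : (0 : ℝ) < d := by exact_mod_cast hd
  have hT : K.trace = R * (1 - ρ) := by rw [hR, effRadius, div_mul_cancel₀ _ h1ρ.ne']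
  have hTpos : 0 < K.trace := hd'.trans_le (card_le_trace h)
  have hRpos : 0 < R := by rw [hR, effRadius]; positivity
  -- With this value lK_jj ≤ l·tr K = (1-ρ)/8, which is in the range of the Gaussian bound and makes
  -- the term quadratic in l at most l(1-ρ)V/3.
  set l : ℝ := 1 / (8 * R) with hl
  have hlpos : 0 < l := by positivity
  have hlR : l * R = 1 / 8 := by rw [hl]; field_simp
  set V := energy K with hV
  have hVm : Measurable V := by unfold V energy; fun_prop
  set g : State d → State d → ℝ := fun x e =>
    l * (V (f x + e) - ρ * V x) - 3 / 2 * l * K.trace - l * (1 - ρ) / 3 * V x with hg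
  have hgm : Measurable (Function.uncurry g) := by
    simp only [hg, Function.uncurry_def]
    have h1 : Measurable fun z : State d × State d => V (f z.1 + z.2) :=
      hVm.comp ((hfm.comp measurable_fst).add measurable_snd)
    have h2 : Measurable fun z : State d × State d => V z.1 := hVm.comp measurable_fst
    fun_prop
  have hk : ∀ j, l * K j j ≤ (1 - ρ) / 8 := fun j => by
    calc l * K j j ≤ l * K.trace := by gcongr; exact diag_le_trace h j
      _ = (1 - ρ) / 8 := by rw [hT, ← mul_assoc, hlR]; ring
  have hk0 : ∀ j, 0 ≤ K j j := fun j => zero_le_one.trans (one_le_diag h j)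
  have hg1 : ∀ x, ∫⁻ e, ENNReal.ofReal (Real.exp (g x e)) ∂(stdGaussian (State d)) ≤ 1 := by
    intro x
    have e1 : ∀ e, g x e = (l * (V (f x) - ρ * V x) - 3 / 2 * l * K.trace - l * (1 - ρ) / 3 * V x) +
        ∑ j, (l * K j j * e j ^ 2 + 2 * l * K j j * f x j * e j) := by
      intro e
      have : V (f x + e) = V (f x) + ∑ j, (K j j * e j ^ 2 + 2 * K j j * f x j * e j) := by
        simp only [hV, energy, ← Finset.sum_add_distrib]
        refine Finset.sum_congr rfl fun j _ => ?_
        simp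
        ring
      have e2 : ∑ j, (l * K j j * e j ^ 2 + 2 * l * K j j * f x j * e j) =
          l * ∑ j, (K j j * e j ^ 2 + 2 * K j j * f x j * e j) := by
        rw [Finset.mul_sum]
        exact Finset.sum_congr rfl fun j _ => by ring
      rw [hg, e2]
      simp only [this]
      ring
    simp_rw [e1]
    refine lintegral_exp_affine_quadratic_le_one (fun j => mul_nonneg hlpos.le (hk0 j))
      (fun j => (hk j).trans (by linarith)) ?_
    have hVf : V (f x) ≤ ρ * V x := energy_glm_le h x
    have hVx : 0 ≤ V x := energy_nonneg h x
    have hVfx : 0 ≤ V (f x) := energy_nonneg h _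
    have hsum : ∑ j, (3 / 2 * (l * K j j) + 2 / 3 * (2 * l * K j j * f x j) ^ 2) ≤
        3 / 2 * l * K.trace + l * (1 - ρ) / 3 * V (f x) := by
      rw [Matrix.trace, hV, energy, Finset.mul_sum, Finset.mul_sum, ← Finset.sum_add_distrib]
      refine Finset.sum_le_sum fun j _ => ?_
      have h2 : l * K j j * (l * (K j j * f x j ^ 2)) ≤ (1 - ρ) / 8 * (l * (K j j * f x j ^ 2)) :=
        mul_le_mul_of_nonneg_right (hk j)
          (mul_nonneg hlpos.le (mul_nonneg (hk0 j) (sq_nonneg _)))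
      simp only [Matrix.diag_apply]
      nlinarith
    have h3 : V (f x) ≤ V x := hVf.trans (by nlinarith)
    have h4 : l * (V (f x) - ρ * V x) ≤ 0 := by nlinarith
    have h5 : l * (1 - ρ) / 3 * V (f x) ≤ l * (1 - ρ) / 3 * V x := by gcongr
    linarith
  refine (measure_mono ?_).trans (measure_exp_sum_ge_le hm hind hlaw hfm hgm hg1
    (Nat.le_succ n) hp)
  intro ω hω
  by_contra hcon
  replace hcon : ¬ Real.log (1 / p) ≤ ∑ i ∈ Finset.range n,
      g (trajectory f (fun i => ε i ω) i) (ε i ω) := hcon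
  refine hω ?_
  set x := trajectory f (fun i => ε i ω) with hx
  rw [not_le] at hcon
  have hx1 : ∀ i, f (x i) + ε i ω = x (i + 1) := fun i => rfl
  simp only [hg, hx1] at hcon
  rw [Finset.sum_sub_distrib, Finset.sum_sub_distrib, ← Finset.mul_sum, ← Finset.mul_sum,
    Finset.sum_sub_distrib, ← Finset.mul_sum, sum_range_succ_eq_sum_Icc (fun i => V (x i)),
    Finset.sum_const, Finset.card_range, nsmul_eq_mul, ← Finset.mul_sum] at hcon
  have hle := sum_range_le_sum_Icc (h := fun i => V (x i)) (by simp [hx, trajectory, hV, energy])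
    (fun i => energy_nonneg h _) n
  set A := ∑ i ∈ Finset.Icc 1 n, V (x i)
  set B := ∑ i ∈ Finset.range n, V (x i)
  -- `B` runs over times 0 to n-1 and `A` over 1 to n. Since x_0 = 0, B ≤ A, and a fraction 2(1-ρ)/3
  -- of `A` survives on the left.
  have h6 : (ρ + (1 - ρ) / 3) * B ≤ (ρ + (1 - ρ) / 3) * A :=
    mul_le_mul_of_nonneg_left hle (by linarith)
  have h6' := mul_le_mul_of_nonneg_left h6 hlpos.le
  have h7 : l * (2 / 3 * (1 - ρ) * A) < Real.log (1 / p) + n * (3 / 2 * l * K.trace) := by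
    linarith
  have h8 : 2 / 3 * (1 - ρ) * A < 8 * R * Real.log (1 / p) + n * (3 / 2 * K.trace) := by
    have h9 := mul_lt_mul_of_pos_left h7 (by positivity : 0 < 8 * R)
    have e1 : 8 * R * (l * (2 / 3 * (1 - ρ) * A)) = (8 * (l * R)) * (2 / 3 * (1 - ρ) * A) := by ring
    have e2 : 8 * R * (Real.log (1 / p) + n * (3 / 2 * l * K.trace)) =
      8 * R * Real.log (1 / p) + 8 * (l * R) * (n * (3 / 2 * K.trace)) := by ring
    rw [e1, e2, hlR] at h9
    linarith
  have e3 : 9 / 4 * (n * R) + 12 * R * Real.log (1 / p) / (1 - ρ) =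
      (3 / 2) * (8 * R * Real.log (1 / p) + n * (3 / 2 * K.trace)) / (1 - ρ) := by
    rw [hT]; field_simp; ring
  rw [e3, le_div_iff₀ h1ρ]
  linarith

/-- The compensator involves the realized squares of x_k, so no prior bound on the states is
required; l remains free for later tuning. -/
theorem noise_deviation (hm : ∀ i ≤ n, Measurable (ε i))
    (hind : iIndepFun (fun i : Fin (n + 1) => ε i) μ)
    (hlaw : ∀ i ≤ n, μ.map (ε i) = stdGaussian (State d)) (Θ : Mat d) (l : ℝ) (j k : Fin d)
    {p : ℝ} (hp : 0 < p) :
    μ {ω | ¬ l * ∑ i ∈ Finset.Icc 1 n, ε i ω j * trajectory (glm relu Θ) (fun i => ε i ω) i k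
      ≤ 2 / 3 * l ^ 2 * ∑ i ∈ Finset.Icc 1 n, trajectory (glm relu Θ) (fun i => ε i ω) i k ^ 2
        + Real.log (1 / p)} ≤ ENNReal.ofReal p := by
  set f := glm relu Θ with hf
  have hfm : Measurable f := measurable_glm_relu Θ
  set g : State d → State d → ℝ := fun x e => l * (e j * x k) - 2 / 3 * l ^ 2 * x k ^ 2 with hg
  have hgm : Measurable (Function.uncurry g) := by
    simp only [hg, Function.uncurry_def]
    fun_prop
  have hg1 : ∀ x, ∫⁻ e, ENNReal.ofReal (Real.exp (g x e)) ∂(stdGaussian (State d)) ≤ 1 := by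
    intro x
    have e1 : ∀ e : State d, g x e = (- (2 / 3 * l ^ 2 * x k ^ 2)) +
        ∑ i, (0 * e i ^ 2 + (if i = j then l * x k else 0) * e i) := by
      intro e
      simp [hg]
      ring
    simp_rw [e1]
    refine lintegral_exp_affine_quadratic_le_one (t := fun _ => 0)
      (s := fun i => if i = j then l * x k else 0) (fun j => le_rfl) (fun j => by norm_num) ?_
    simp [ite_pow]
    linarith
  refine (measure_mono ?_).trans (measure_exp_sum_ge_le hm hind hlaw hfm hgm hg1 le_rfl hp)
  intro ω hω
  by_contra hcon
  replace hcon : ¬ Real.log (1 / p) ≤ ∑ i ∈ Finset.range (n + 1),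
      g (trajectory f (fun i => ε i ω) i) (ε i ω) := hcon
  refine hω ?_
  set x := trajectory f (fun i => ε i ω) with hx
  -- The noises 0 to n are used, and the term at time 0 vanishes because x_0 = 0.
  rw [not_le, Finset.sum_range_succ',
    sum_range_succ_eq_sum_Icc (fun i => g (x i) (ε i ω))] at hcon
  have h0 : g (x 0) (ε 0 ω) = 0 := by simp [hg, hx, trajectory]
  rw [h0, add_zero] at hcon
  simp only [hg] at hcon
  rw [Finset.sum_sub_distrib, ← Finset.mul_sum, ← Finset.mul_sum] at hcon
  linarith

/-- A lower-tail bound for nonnegative variables: exp(-y) ≤ 1 - y/2 on [0,1], and the conditional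
mean is bounded below by `sq_integral_le_integral_shift`. -/
theorem minorant_deviation (hm : ∀ i ≤ n, Measurable (ε i))
    (hind : iIndepFun (fun i : Fin (n + 1) => ε i) μ)
    (hlaw : ∀ i ≤ n, μ.map (ε i) = stdGaussian (State d)) (Θ : Mat d) {Φ : State d → ℝ}
    (hΦm : Measurable Φ) (hΦ0 : ∀ x, 0 ≤ Φ x) (hΦ1 : ∀ x, Φ x ≤ 1)
    (hΦ : smallBall ≤ ∫ x, Φ x ∂(stdGaussian (State d))) {p : ℝ} (hp : 0 < p) :
    μ {ω | ¬ smallBall ^ 2 / 2 * ∑ i ∈ Finset.range n,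
        Real.exp (-‖glm relu Θ (trajectory (glm relu Θ) (fun i => ε i ω) i)‖ ^ 2)
        - Real.log (1 / p)
      ≤ ∑ i ∈ Finset.Icc 1 n, Φ (trajectory (glm relu Θ) (fun i => ε i ω) i)}
      ≤ ENNReal.ofReal p := by
  set f := glm relu Θ with hf
  have hfm : Measurable f := measurable_glm_relu Θ
  set g : State d → State d → ℝ := fun x e =>
    smallBall ^ 2 / 2 * Real.exp (-‖f x‖ ^ 2) - Φ (f x + e) with hg
  have hgm : Measurable (Function.uncurry g) := by
    simp only [hg, Function.uncurry_def]
    have h1 : Measurable fun z : State d × State d => Φ (f z.1 + z.2) :=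
      hΦm.comp ((hfm.comp measurable_fst).add measurable_snd)
    have h2 : Measurable fun z : State d × State d => f z.1 := hfm.comp measurable_fst
    fun_prop
  have hg1 : ∀ x, ∫⁻ e, ENNReal.ofReal (Real.exp (g x e)) ∂(stdGaussian (State d)) ≤ 1 := by
    intro x
    set γ := stdGaussian (State d)
    set c := smallBall ^ 2 / 2 * Real.exp (-‖f x‖ ^ 2) with hc
    set I := ∫ e, Φ (f x + e) ∂γ with hI
    have hi : Integrable (fun e => Φ (f x + e)) γ :=
      integrable_of_mem_unit (by fun_prop) (fun _ => hΦ0 _) fun _ => hΦ1 _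
    have hcI : c ≤ I / 2 := by
      have h1 := sq_integral_le_integral_shift Φ hΦm hΦ0 hΦ1 (f x)
      have h2 : smallBall ^ 2 ≤ (∫ x, Φ x ∂γ) ^ 2 := pow_le_pow_left₀ smallBall_pos.le hΦ 2
      have h3 := mul_le_mul_of_nonneg_right h2 (Real.exp_pos (-‖f x‖ ^ 2)).le
      rw [hc]
      linarith
    have hpt : ∀ e, Real.exp (g x e) ≤ Real.exp c * (1 - Φ (f x + e) / 2) := by
      intro e
      have e1 : g x e = c + -Φ (f x + e) := by simp only [hg, hc]; ring
      rw [e1, Real.exp_add]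
      gcongr
      set y := Φ (f x + e)
      have hy0 : 0 ≤ y := hΦ0 _
      have hy1 : y ≤ 1 := hΦ1 _
      have h1 := Real.add_one_le_exp y
      have h2 := Real.exp_pos y
      rw [Real.exp_neg, inv_le_iff_one_le_mul₀ h2]
      nlinarith
    calc ∫⁻ e, ENNReal.ofReal (Real.exp (g x e)) ∂γ
        ≤ ∫⁻ e, ENNReal.ofReal (Real.exp c * (1 - Φ (f x + e) / 2)) ∂γ :=
          lintegral_mono fun e => ENNReal.ofReal_le_ofReal (hpt e)
      _ = ENNReal.ofReal (∫ e, Real.exp c * (1 - Φ (f x + e) / 2) ∂γ) := by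
          have hi2 : Integrable (fun e => Real.exp c * (1 - Φ (f x + e) / 2)) γ :=
            ((integrable_const 1).sub (hi.div_const 2)).const_mul _
          rw [ofReal_integral_eq_lintegral_ofReal hi2]
          refine Filter.Eventually.of_forall fun e => ?_
          have := hΦ1 (f x + e)
          exact mul_nonneg (Real.exp_pos _).le (by linarith)
      _ ≤ ENNReal.ofReal 1 := by
          refine ENNReal.ofReal_le_ofReal ?_
          rw [integral_const_mul, integral_sub (integrable_const _) (hi.div_const 2),
            integral_div]
          simp only [integral_const, probReal_univ, smul_eq_mul, mul_one]
          rw [← hI]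
          have h1 : 1 - I / 2 ≤ Real.exp (-c) := by
            linarith [Real.add_one_le_exp (-c)]
          calc Real.exp c * (1 - I / 2) ≤ Real.exp c * Real.exp (-c) := by gcongr
            _ = 1 := by rw [← Real.exp_add]; simp
      _ = 1 := ENNReal.ofReal_one
  refine (measure_mono ?_).trans (measure_exp_sum_ge_le hm hind hlaw hfm hgm hg1
    (Nat.le_succ n) hp)
  intro ω hω
  by_contra hcon
  replace hcon : ¬ Real.log (1 / p) ≤ ∑ i ∈ Finset.range n,
      g (trajectory f (fun i => ε i ω) i) (ε i ω) := hcon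
  refine hω ?_
  set x := trajectory f (fun i => ε i ω) with hx
  have hx1 : ∀ i, f (x i) + ε i ω = x (i + 1) := fun i => rfl
  simp only [hg, hx1] at hcon
  rw [not_le, Finset.sum_sub_distrib, ← Finset.mul_sum,
    sum_range_succ_eq_sum_Icc (fun i => Φ (x i))] at hcon
  linarith

end Events

/-! ### Union bounds -/

section GoodEvent

variable {d : ℕ} {Ω : Type*} [MeasurableSpace Ω] {μ : Measure Ω} [IsProbabilityMeasure μ] {n : ℕ}
  {ε : ℕ → Ω → State d}

theorem curvature_event (hd : 0 < d) (hm : ∀ i ≤ n, Measurable (ε i))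
    (hind : iIndepFun (fun i : Fin (n + 1) => ε i) μ)
    (hlaw : ∀ i ≤ n, μ.map (ε i) = stdGaussian (State d)) (Θ : Mat d) {M : ℕ} (hM : 0 < M)
    {δ : ℝ} (hδ : 0 < δ) :
    ∃ bad : Set Ω, μ bad ≤ ENNReal.ofReal (δ / 4) ∧ ∀ ω ∉ bad, ∀ j, ∀ θ : State d,
      ((smallBall ^ 2 / 2 * ∑ i ∈ Finset.range n,
          Real.exp (-‖glm relu Θ (trajectory (glm relu Θ) (fun i => ε i ω) i)‖ ^ 2)
          - Real.log (8 * d * (2 * M + 1) ^ d / δ)) / 2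
        - d / (M : ℝ) ^ 2 *
          ∑ i ∈ Finset.Icc 1 n, ‖trajectory (glm relu Θ) (fun i => ε i ω) i‖ ^ 2)
        * ‖θ - row Θ j‖ ^ 2 ≤
      ∑ i ∈ Finset.Icc 1 n,
        (max (inner ℝ θ (trajectory (glm relu Θ) (fun i => ε i ω) i)) 0
          - max (inner ℝ (row Θ j) (trajectory (glm relu Θ) (fun i => ε i ω) i)) 0) ^ 2 := by
  obtain ⟨r, hr1, hr⟩ := exists_sphere_net hd hM
  choose Φ hΦm hΦ0 hΦ1 hΦ hΦs using fun j c => exists_relu_minorants (row Θ j) (r c) (hr1 c)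
  have hd' : (0 : ℝ) < d := by exact_mod_cast hd
  set N : ℝ := (2 * M + 1) ^ d with hN
  have hNpos : 0 < N := by positivity
  -- There are 2dN events: d rows, N net directions and two minorants each.
  set p : ℝ := δ / (8 * d * N) with hp
  have hppos : 0 < p := by positivity
  have h1p : 1 / p = 8 * d * N / δ := by rw [hp, one_div_div]
  refine ⟨⋃ q : Fin d × (Fin d → Fin (2 * M + 1)) × Bool, {ω | ¬ smallBall ^ 2 / 2 *
      ∑ i ∈ Finset.range n,
        Real.exp (-‖glm relu Θ (trajectory (glm relu Θ) (fun i => ε i ω) i)‖ ^ 2)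
        - Real.log (1 / p) ≤ ∑ i ∈ Finset.Icc 1 n,
          Φ q.1 q.2.1 q.2.2 (trajectory (glm relu Θ) (fun i => ε i ω) i)}, ?_, ?_⟩
  · refine (measure_iUnion_le_card_mul
      fun q : Fin d × (Fin d → Fin (2 * M + 1)) × Bool => minorant_deviation hm hind hlaw Θ
      (hΦm q.1 q.2.1 q.2.2) (hΦ0 _ _ _) (hΦ1 _ _ _) (hΦ _ _ _) hppos).trans ?_
    refine ENNReal.ofReal_le_ofReal (le_of_eq ?_)
    simp only [Fintype.card_prod, Fintype.card_fin, Fintype.card_bool, Fintype.card_fun]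
    push_cast
    rw [← hN, hp]
    field_simp
    norm_num
  · intro ω hω j θ
    rw [Set.mem_iUnion, not_exists] at hω
    refine relu_row_lower_bound (row Θ j) r (Φ j) (hΦs j) hr (Finset.Icc 1 n) _
      (fun c b => ?_) θ
    rw [← h1p]
    exact not_not.1 (hω (j, c, b))

theorem noise_event (hd : 0 < d) (hm : ∀ i ≤ n, Measurable (ε i))
    (hind : iIndepFun (fun i : Fin (n + 1) => ε i) μ)
    (hlaw : ∀ i ≤ n, μ.map (ε i) = stdGaussian (State d)) (Θ : Mat d) (l : ℝ)
    {δ : ℝ} (hδ : 0 < δ) :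
    ∃ bad : Set Ω, μ bad ≤ ENNReal.ofReal (δ / 4) ∧ ∀ ω ∉ bad, ∀ j k,
      |l * ∑ i ∈ Finset.Icc 1 n, ε i ω j * trajectory (glm relu Θ) (fun i => ε i ω) i k|
      ≤ 2 / 3 * l ^ 2 * ∑ i ∈ Finset.Icc 1 n, trajectory (glm relu Θ) (fun i => ε i ω) i k ^ 2
        + Real.log (8 * d ^ 2 / δ) := by
  have hd' : (0 : ℝ) < d := by exact_mod_cast hd
  -- There are 2d² events: d² entries and two signs.
  set p : ℝ := δ / (8 * d ^ 2) with hp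
  have hppos : 0 < p := by positivity
  have h1p : 1 / p = 8 * d ^ 2 / δ := by rw [hp, one_div_div]
  set sg : Bool → ℝ := fun b => bif b then l else -l with hsg
  refine ⟨⋃ q : Fin d × Fin d × Bool, {ω | ¬ sg q.2.2 * ∑ i ∈ Finset.Icc 1 n,
      ε i ω q.1 * trajectory (glm relu Θ) (fun i => ε i ω) i q.2.1
      ≤ 2 / 3 * sg q.2.2 ^ 2 * ∑ i ∈ Finset.Icc 1 n,
        trajectory (glm relu Θ) (fun i => ε i ω) i q.2.1 ^ 2
        + Real.log (1 / p)}, ?_, ?_⟩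
  · refine (measure_iUnion_le_card_mul fun q : Fin d × Fin d × Bool => noise_deviation hm hind hlaw Θ
      (sg q.2.2) q.1 q.2.1 hppos).trans ?_
    refine ENNReal.ofReal_le_ofReal (le_of_eq ?_)
    simp only [Fintype.card_prod, Fintype.card_fin, Fintype.card_bool]
    push_cast
    rw [hp]
    field_simp
    norm_num
  · intro ω hω j k
    rw [Set.mem_iUnion, not_exists] at hω
    rw [← h1p, abs_le']
    refine ⟨not_not.1 (hω (j, k, true)), ?_⟩
    have h := not_not.1 (hω (j, k, false))
    simp only [hsg, cond_false, neg_sq] at h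
    rwa [neg_mul] at h

end GoodEvent

/-! ### From the events to curvature and noise size -/

section Deterministic

variable {d : ℕ}

/-- Jensen's inequality for exp(-a), through the tangent line at A. -/
lemma mul_exp_neg_le_sum_exp_neg {n : ℕ} {a : ℕ → ℝ} {A : ℝ}
    (h : ∑ i ∈ Finset.range n, a i ≤ n * A) :
    n * Real.exp (-A) ≤ ∑ i ∈ Finset.range n, Real.exp (-a i) := by
  have h1 : ∀ i, Real.exp (-A) * (1 + (A - a i)) ≤ Real.exp (-a i) := by
    intro i
    have e : -a i = -A + (A - a i) := by ring
    rw [e, Real.exp_add]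
    gcongr
    linarith [Real.add_one_le_exp (A - a i)]
  refine le_trans ?_ (Finset.sum_le_sum fun i _ => h1 i)
  rw [← Finset.mul_sum, Finset.sum_add_distrib, Finset.sum_sub_distrib]
  simp only [Finset.sum_const, Finset.card_range, nsmul_eq_mul, mul_one]
  nlinarith [Real.exp_pos (-A)]

lemma predError_lower_bound {n : ℕ} (hn : 0 < n) {x : ℕ → State d} {Θ' : Mat d} {β : ℝ}
    (h : ∀ j, ∀ θ : State d, n * β * ‖θ - row Θ' j‖ ^ 2 ≤
      ∑ i ∈ Finset.Icc 1 n, (max (inner ℝ θ (x i)) 0 - max (inner ℝ (row Θ' j) (x i)) 0) ^ 2)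
    (Θ : Mat d) : β * ‖Θ - Θ'‖ ^ 2 ≤ predError n x Θ Θ' := by
  have hn' : (0 : ℝ) < n := by exact_mod_cast hn
  rw [norm_sub_sq_eq_sum_rows, predError, Finset.sum_comm, div_mul_eq_mul_div, one_mul,
    le_div_iff₀ hn', Finset.mul_sum, Finset.sum_mul]
  refine Finset.sum_le_sum fun j _ => ?_
  simp only [glm_relu_apply]
  refine le_trans (le_of_eq ?_) (h j (row Θ j))
  ring

lemma noiseGrad_trajectory_sq_le {n : ℕ} (hn : 0 < n) {Θ' : Mat d} {e : ℕ → State d} {C : ℝ}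
    (h : ∀ j k, (∑ i ∈ Finset.Icc 1 n, e i j * trajectory (glm relu Θ') e i k) ^ 2 ≤ n * C) :
    ‖noiseGrad n (trajectory (glm relu Θ') e) Θ'‖ ^ 2 ≤ d ^ 2 * C / n := by
  have hn' : (0 : ℝ) < n := by exact_mod_cast hn
  rw [frobenius_norm_sq]
  have hjk : ∀ j k, noiseGrad n (trajectory (glm relu Θ') e) Θ' j k ^ 2 ≤ C / n := by
    intro j k
    have e1 : noiseGrad n (trajectory (glm relu Θ') e) Θ' j k =
        1 / (n : ℝ) * ∑ i ∈ Finset.Icc 1 n, e i j * trajectory (glm relu Θ') e i k := by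
      simp [noiseGrad, trajectory]
    rw [e1, mul_pow, div_pow, one_pow, div_mul_eq_mul_div, one_mul, div_le_div_iff₀ (by positivity)
      hn']
    have := mul_le_mul_of_nonneg_right (h j k) hn'.le
    linarith
  calc _ ≤ ∑ _j : Fin d, ∑ _k : Fin d, C / n :=
        Finset.sum_le_sum fun j _ => Finset.sum_le_sum fun k _ => hjk j k
    _ = d ^ 2 * C / n := by simp; ring

end Deterministic

/-! ### Net size and logarithmic factors -/

section Numerics

/-- Sample sizes beyond `largeSample` times the complexity of the problem make the curvature
estimate effective. -/
noncomputable def largeSample : ℝ :=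
  4 * (Real.log (240 / smallBall ^ 2) + 10) / smallBall ^ 2 + 48

lemma log_smallBall_nonneg : 0 ≤ Real.log (240 / smallBall ^ 2) := by
  refine Real.log_nonneg ?_
  rw [le_div_iff₀ (pow_pos smallBall_pos 2)]
  nlinarith [smallBall_pos, smallBall_le_one]

lemma largeSample_ge : 48 ≤ largeSample := by
  have := log_smallBall_nonneg
  have := smallBall_pos
  unfold largeSample
  have : 0 ≤ 4 * (Real.log (240 / smallBall ^ 2) + 10) / smallBall ^ 2 := by positivity
  linarith

/-- The resolution of the net used for the curvature estimate. -/
noncomputable def netSize (d : ℕ) (R ρ : ℝ) : ℕ :=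
  ⌈48 * d * R * Real.exp (3 * ρ * R) / smallBall ^ 2⌉₊

variable {d n : ℕ} {R ρ δ : ℝ}

lemma one_le_netSize_arg (hd : 1 ≤ (d : ℝ)) (hR : 1 ≤ R) (hρ : 0 ≤ ρ) :
    1 ≤ 48 * d * R * Real.exp (3 * ρ * R) / smallBall ^ 2 := by
  have h1 : 1 ≤ Real.exp (3 * ρ * R) := Real.one_le_exp (by positivity)
  rw [le_div_iff₀ (pow_pos smallBall_pos 2), one_mul]
  have h2 : smallBall ^ 2 ≤ 1 := pow_le_one₀ smallBall_pos.le smallBall_le_one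
  have h3 : 1 ≤ (d : ℝ) * R := by nlinarith
  have h4 : 1 ≤ (d : ℝ) * R * Real.exp (3 * ρ * R) := by nlinarith
  linarith

lemma log_netSize_le (hd : 1 ≤ (d : ℝ)) (hR : 1 ≤ R) (hρ : 0 ≤ ρ) :
    Real.log (2 * netSize d R ρ + 1) ≤
      Real.log (240 / smallBall ^ 2) + Real.log d + Real.log R + 3 * ρ * R := by
  have hy := one_le_netSize_arg hd hR hρ
  set y := 48 * d * R * Real.exp (3 * ρ * R) / smallBall ^ 2 with hydef
  have hM : (netSize d R ρ : ℝ) < y + 1 := Nat.ceil_lt_add_one (by linarith)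
  have hκ := pow_pos smallBall_pos 2
  -- Rounding up gives at most 2y + 3, which is at most 5y since y ≥ 1.
  have h5 : 2 * (netSize d R ρ : ℝ) + 1 ≤ 240 / smallBall ^ 2 * d * R * Real.exp (3 * ρ * R) := by
    have : 240 / smallBall ^ 2 * d * R * Real.exp (3 * ρ * R) = 5 * y := by rw [hydef]; ring
    linarith
  refine (Real.log_le_log (by positivity) h5).trans (le_of_eq ?_)
  rw [Real.log_mul (by positivity) (by positivity), Real.log_mul (by positivity) (by positivity),
    Real.log_mul (by positivity) (by positivity), Real.log_exp]

lemma logFactor_bounds (hd : 1 ≤ (d : ℝ)) (hdR : (d : ℝ) ≤ R) (hn : 1 ≤ (n : ℝ)) (hδ : 0 < δ)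
    (hδ1 : δ < 1) {L : ℝ} (hL : L = Real.log (2 * R * n / δ + 1)) :
    1 ≤ L ∧ Real.log 2 ≤ L ∧ Real.log (1 / δ) ≤ L ∧ Real.log d ≤ L ∧ Real.log R ≤ L := by
  have hR : 1 ≤ R := hd.trans hdR
  have hRn : 1 ≤ R * n := by nlinarith
  have h1δ : 1 ≤ 1 / δ := by rw [le_div_iff₀ hδ]; linarith
  have hX : 2 * R * n / δ + 1 = 2 * (R * n) * (1 / δ) + 1 := by ring
  have a1 : 2 * (1 / δ) ≤ 2 * (R * n) * (1 / δ) := by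
    refine mul_le_mul_of_nonneg_right ?_ (by positivity); linarith
  have a2 : 2 * (R * n) ≤ 2 * (R * n) * (1 / δ) := by
    nlinarith
  have a3 : R ≤ R * n := by nlinarith
  subst hL
  rw [hX]
  refine ⟨?_, ?_, ?_, ?_, ?_⟩
  · rw [Real.le_log_iff_exp_le (by positivity)]
    linarith [Real.exp_one_lt_d9]
  all_goals exact Real.log_le_log (by positivity) (by linarith)

end Numerics

/-! ### The error bound for large samples -/

section LargeSample

variable {d n : ℕ} {R ρ δ L : ℝ}

/-- The first conclusion keeps the energy deviation below 3nR/4. The second keeps the union bound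
over the net below half of the main curvature term. -/
lemma log_card_le_of_large (hd : 1 ≤ (d : ℝ)) (hdR : (d : ℝ) ≤ R) (hn : 1 ≤ (n : ℝ)) (hδ : 0 < δ)
    (hδ1 : δ < 1) (hρ0 : 0 ≤ ρ) (hρ1 : ρ < 1) (hL : L = Real.log (2 * R * n / δ + 1))
    (hbig : largeSample * Real.exp (8 * ρ * R) * d ^ 2 * R ^ 2 * L ^ 2 / (1 - ρ) ^ 2 ≤ n) :
    48 * L ≤ n * (1 - ρ) ∧
    Real.log (8 * d * (2 * netSize d R ρ + 1) ^ d / δ) ≤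
      n * (smallBall ^ 2 / 4 * Real.exp (-(3 * ρ * R))) := by
  obtain ⟨hL1, hL2, hLδ, hLd, hLR⟩ := logFactor_bounds hd hdR hn hδ hδ1 hL
  have hR : 1 ≤ R := hd.trans hdR
  have hκ := pow_pos smallBall_pos 2
  have h1ρ : 0 < 1 - ρ := by linarith
  have hls := largeSample_ge
  have hls0 : 0 ≤ largeSample := by linarith
  have hE8 : 1 ≤ Real.exp (8 * ρ * R) := Real.one_le_exp (by positivity)
  have hdR1 : 1 ≤ (d : ℝ) * R := by nlinarith
  have hbase : largeSample * Real.exp (8 * ρ * R) * (d * R * L) ≤ n * (1 - ρ) ^ 2 := by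
    have h1 := (div_le_iff₀ (by positivity)).1 hbig
    refine le_trans ?_ h1
    have e : largeSample * Real.exp (8 * ρ * R) * d ^ 2 * R ^ 2 * L ^ 2 =
      largeSample * Real.exp (8 * ρ * R) * ((d * R * L) * (d * R * L)) := by ring
    rw [e]
    have h2 : 1 ≤ (d : ℝ) * R * L := one_le_mul_of_one_le_of_one_le hdR1 hL1
    exact mul_le_mul_of_nonneg_left (le_mul_of_one_le_left (by linarith) h2) (by positivity)
  refine ⟨?_, ?_⟩
  · have h1 : 48 * L ≤ largeSample * Real.exp (8 * ρ * R) * (d * R * L) := by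
      have h3 : 48 ≤ largeSample * Real.exp (8 * ρ * R) := by nlinarith
      have h4 : L ≤ d * R * L := le_mul_of_one_le_left (by linarith) hdR1
      calc 48 * L ≤ (largeSample * Real.exp (8 * ρ * R)) * L := by gcongr
        _ ≤ _ := by gcongr
    have h2 : (n : ℝ) * (1 - ρ) ^ 2 ≤ n * (1 - ρ) := by
      refine mul_le_mul_of_nonneg_left ?_ (by linarith)
      nlinarith
    linarith
  · have hlog : Real.log (8 * d * (2 * netSize d R ρ + 1) ^ d / δ) =
        3 * Real.log 2 + Real.log d + d * Real.log (2 * netSize d R ρ + 1) + Real.log (1 / δ) := by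
      have e : 8 * (d : ℝ) * (2 * netSize d R ρ + 1) ^ d / δ =
        2 ^ 3 * (d : ℝ) * (2 * netSize d R ρ + 1) ^ d * (1 / δ) := by ring
      rw [e, Real.log_mul (by positivity) (by positivity), Real.log_mul (by positivity)
        (by positivity), Real.log_mul (by positivity) (by positivity), Real.log_pow, Real.log_pow]
      push_cast
      ring
    set c := Real.log (240 / smallBall ^ 2) with hc
    have hc0 : 0 ≤ c := log_smallBall_nonneg
    have hM := log_netSize_le hd hR hρ0
    have hM2 : Real.log (2 * netSize d R ρ + 1) ≤ (c + 5) * (R * L) := by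
      have h1 : 1 ≤ R * L := one_le_mul_of_one_le_of_one_le hR hL1
      have h2 : L ≤ R * L := le_mul_of_one_le_left (by linarith) hR
      have h3 : ρ * R ≤ L * R := mul_le_mul_of_nonneg_right (by linarith) (by linarith)
      have h4 : c ≤ c * (R * L) := le_mul_of_one_le_right hc0 h1
      have e : (c + 5) * (R * L) = c * (R * L) + 2 * (R * L) + 3 * (L * R) := by ring
      rw [e]
      linarith
    have h5 : Real.log (8 * d * (2 * netSize d R ρ + 1) ^ d / δ) ≤ (c + 10) * (d * R * L) := by
      rw [hlog]
      have h6 : (d : ℝ) * Real.log (2 * netSize d R ρ + 1) ≤ d * ((c + 5) * (R * L)) := by gcongr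
      have h7 : L ≤ d * R * L := le_mul_of_one_le_left (by linarith) hdR1
      have e : (c + 10) * (d * R * L) = d * ((c + 5) * (R * L)) + 5 * (d * R * L) := by ring
      rw [e]
      linarith
    refine h5.trans ?_
    have h8 : 4 * (c + 10) / smallBall ^ 2 ≤ largeSample := by
      unfold largeSample; linarith
    have h9 : 4 * (c + 10) / smallBall ^ 2 * Real.exp (8 * ρ * R) * (d * R * L) ≤ n := by
      have h10 : (n : ℝ) * (1 - ρ) ^ 2 ≤ n * 1 := by
        refine mul_le_mul_of_nonneg_left ?_ (by linarith)
        nlinarith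
      refine le_trans ?_ (hbase.trans (h10.trans (mul_one _).le))
      gcongr
    have h11 : Real.exp (8 * ρ * R) * Real.exp (-(3 * ρ * R)) ≥ 1 := by
      rw [← Real.exp_add]
      exact Real.one_le_exp (by have : 0 ≤ ρ * R := by positivity
                                linarith)
    have hne := smallBall_pos.ne'
    calc (c + 10) * (d * R * L) ≤ (c + 10) * (d * R * L) *
          (Real.exp (8 * ρ * R) * Real.exp (-(3 * ρ * R))) :=
          le_mul_of_one_le_right (by positivity) h11
      _ = (4 * (c + 10) / smallBall ^ 2 * Real.exp (8 * ρ * R) * (d * R * L)) *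
          (smallBall ^ 2 / 4 * Real.exp (-(3 * ρ * R))) := by field_simp
      _ ≤ _ := by gcongr

/-- The multiplicative constant of the error bound for large samples. -/
noncomputable def errorConst : ℝ := 2 + 110592 / smallBall ^ 4

lemma log_card_entries_le (hd : 1 ≤ (d : ℝ)) (hdR : (d : ℝ) ≤ R) (hn : 1 ≤ (n : ℝ)) (hδ : 0 < δ)
    (hδ1 : δ < 1) (hL : L = Real.log (2 * R * n / δ + 1)) :
    0 < Real.log (8 * d ^ 2 / δ) ∧ Real.log (8 * d ^ 2 / δ) ≤ 6 * L ∧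
      Real.log (1 / (δ / 4)) ≤ 3 * L := by
  obtain ⟨hL1, hL2, hLδ, hLd, hLR⟩ := logFactor_bounds hd hdR hn hδ hδ1 hL
  refine ⟨Real.log_pos ?_, ?_, ?_⟩
  · rw [lt_div_iff₀ hδ]; nlinarith
  · have e : 8 * (d : ℝ) ^ 2 / δ = 2 ^ 3 * (d : ℝ) ^ 2 * (1 / δ) := by ring
    rw [e, Real.log_mul (by positivity) (by positivity), Real.log_mul (by positivity)
      (by positivity), Real.log_pow, Real.log_pow]
    push_cast
    linarith
  · have e : 1 / (δ / 4) = 2 ^ 2 * (1 / δ) := by field_simp; norm_num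
    rw [e, Real.log_mul (by positivity) (by positivity), Real.log_pow]
    push_cast
    linarith

/-- With b as in the proof, the main term is at least 2nb, the union bound costs nb, halving leaves
nb/2 and the net error takes nb/4. The remaining nb/4 is at least nα. -/
lemma curvature_of_events {Θ' K : Mat d} (h : IsLyapunovStable Θ' K ρ) (hd : 1 ≤ (d : ℝ))
    (hR : 1 ≤ R) (hn : 0 < n) {e : ℕ → State d}
    (hA : ∑ i ∈ Finset.Icc 1 n, energy K (trajectory (glm relu Θ') e i) ≤ 3 * (n * R))
    {Λ : ℝ} (hΛ : Λ ≤ n * (smallBall ^ 2 / 4 * Real.exp (-(3 * ρ * R))))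
    (hC : ∀ j, ∀ θ : State d,
      ((smallBall ^ 2 / 2 * ∑ i ∈ Finset.range n,
          Real.exp (-‖glm relu Θ' (trajectory (glm relu Θ') e i)‖ ^ 2) - Λ) / 2
        - d / (netSize d R ρ : ℝ) ^ 2 *
          ∑ i ∈ Finset.Icc 1 n, ‖trajectory (glm relu Θ') e i‖ ^ 2) * ‖θ - row Θ' j‖ ^ 2 ≤
      ∑ i ∈ Finset.Icc 1 n, (max (inner ℝ θ (trajectory (glm relu Θ') e i)) 0
          - max (inner ℝ (row Θ' j) (trajectory (glm relu Θ') e i)) 0) ^ 2) (Θ : Mat d) :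
    smallBall ^ 2 / 16 * Real.exp (-(4 * ρ * R)) * ‖Θ - Θ'‖ ^ 2 ≤
      predError n (trajectory (glm relu Θ') e) Θ Θ' := by
  have hρ0 := h.rho_nonneg
  have hκ := pow_pos smallBall_pos 2
  have hn' : (0 : ℝ) < n := by exact_mod_cast hn
  set x := trajectory (glm relu Θ') e with hx
  refine predError_lower_bound hn (fun j θ => le_trans ?_ (hC j θ)) Θ
  refine mul_le_mul_of_nonneg_right ?_ (sq_nonneg _)
  have hS : ∑ i ∈ Finset.Icc 1 n, ‖x i‖ ^ 2 ≤ 3 * (n * R) :=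
    (Finset.sum_le_sum fun i _ => norm_sq_le_energy h (x i)).trans hA
  have hμ : ∑ i ∈ Finset.range n, ‖glm relu Θ' (x i)‖ ^ 2 ≤ n * (3 * ρ * R) := by
    have h1 : ∑ i ∈ Finset.range n, energy K (x i) ≤ 3 * (n * R) :=
      (sum_range_le_sum_Icc (h := fun i => energy K (x i)) (by simp [hx, trajectory, energy])
        (fun i => energy_nonneg h _) n).trans hA
    calc ∑ i ∈ Finset.range n, ‖glm relu Θ' (x i)‖ ^ 2
        ≤ ∑ i ∈ Finset.range n, ρ * energy K (x i) := Finset.sum_le_sum fun i _ =>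
          (norm_sq_le_energy h _).trans (energy_glm_le h _)
      _ = ρ * ∑ i ∈ Finset.range n, energy K (x i) := by rw [Finset.mul_sum]
      _ ≤ ρ * (3 * (n * R)) := by gcongr
      _ = _ := by ring
  have hexp := mul_exp_neg_le_sum_exp_neg hμ
  set y := 48 * d * R * Real.exp (3 * ρ * R) / smallBall ^ 2 with hy
  have hy1 : 1 ≤ y := one_le_netSize_arg hd hR hρ0
  have hMy : y ≤ netSize d R ρ := Nat.le_ceil _
  have hM2 : y ≤ (netSize d R ρ : ℝ) ^ 2 := by nlinarith
  set b := smallBall ^ 2 / 4 * Real.exp (-(3 * ρ * R)) with hb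
  have hbpos : 0 < b := by positivity
  have hyb : y * b = 12 * (d * R) := by
    have : Real.exp (3 * ρ * R) * Real.exp (-(3 * ρ * R)) = 1 := by
      rw [← Real.exp_add]; simp
    calc y * b = 12 * (d * R) * (Real.exp (3 * ρ * R) * Real.exp (-(3 * ρ * R))) := by
          have hne := smallBall_pos.ne'
          rw [hy, hb]; field_simp; norm_num
      _ = _ := by rw [this, mul_one]
  have hnet : d / (netSize d R ρ : ℝ) ^ 2 * ∑ i ∈ Finset.Icc 1 n, ‖x i‖ ^ 2 ≤ n * b / 4 := by
    calc d / (netSize d R ρ : ℝ) ^ 2 * ∑ i ∈ Finset.Icc 1 n, ‖x i‖ ^ 2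
        ≤ d / y * (3 * (n * R)) := by gcongr
      _ = n * b / 4 := by
        rw [div_mul_eq_mul_div, div_eq_iff (by positivity)]
        linear_combination (-(n : ℝ) / 4) * hyb
  have hα : smallBall ^ 2 / 16 * Real.exp (-(4 * ρ * R)) ≤ b / 4 := by
    have : Real.exp (-(4 * ρ * R)) ≤ Real.exp (-(3 * ρ * R)) := by
      refine Real.exp_le_exp.2 ?_
      have : 0 ≤ ρ * R := by positivity
      linarith
    rw [hb]
    nlinarith
  have hα' := mul_le_mul_of_nonneg_left hα hn'.le
  have hexp' := mul_le_mul_of_nonneg_left hexp (by positivity : 0 ≤ smallBall ^ 2 / 2)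
  have e2 : smallBall ^ 2 / 2 * (n * Real.exp (-(3 * ρ * R))) = 2 * (n * b) := by rw [hb]; ring
  rw [e2] at hexp'
  linarith

lemma contraction_factor_le (hR : 1 ≤ R) (hρ0 : 0 ≤ ρ) {m : ℕ} (hm : 1 ≤ m) (hn : 0 < n)
    (hmn : 512 / smallBall ^ 2 * (4 * R) ^ 2 * Real.exp (8 * ρ * R) * Real.log n ≤ m) :
    Real.exp (-(((16 * R) ^ 2)⁻¹ * Real.exp (-(4 * ρ * R)) *
      (smallBall ^ 2 / 16 * Real.exp (-(4 * ρ * R))) / 2 * (m - 1 : ℕ))) ≤ 2 / n := by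
  have hn' : (0 : ℝ) < n := by exact_mod_cast hn
  have hκ := pow_pos smallBall_pos 2
  have hκ1 : smallBall ^ 2 ≤ 1 := pow_le_one₀ smallBall_pos.le smallBall_le_one
  set E := Real.exp (8 * ρ * R) with hE
  have hE0 : 0 < E := Real.exp_pos _
  have hE1 : 1 ≤ E := Real.one_le_exp (by positivity)
  have hEE : Real.exp (-(4 * ρ * R)) * Real.exp (-(4 * ρ * R)) = E⁻¹ := by
    rw [← Real.exp_add, hE, ← Real.exp_neg]; congr 1; ring
  have e1 : ((16 * R) ^ 2)⁻¹ * Real.exp (-(4 * ρ * R)) *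
      (smallBall ^ 2 / 16 * Real.exp (-(4 * ρ * R))) / 2 = smallBall ^ 2 / (8192 * R ^ 2 * E) := by
    calc _ = ((16 * R) ^ 2)⁻¹ * (smallBall ^ 2 / 16) *
          (Real.exp (-(4 * ρ * R)) * Real.exp (-(4 * ρ * R))) / 2 := by ring
      _ = _ := by rw [hEE]; field_simp; ring
  rw [e1, Nat.cast_sub hm, Nat.cast_one]
  set q := smallBall ^ 2 / (8192 * R ^ 2 * E) with hq
  have hq0 : 0 < q := by positivity
  have hq1 : q ≤ 1 / 2 := by
    rw [hq, div_le_iff₀ (by positivity)]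
    have : 1 ≤ R ^ 2 * E := by nlinarith
    nlinarith
  have hlog : Real.log n ≤ q * m := by
    have h1 := mul_le_mul_of_nonneg_left hmn hq0.le
    have h2 : q * (512 / smallBall ^ 2 * (4 * R) ^ 2 * E * Real.log n) = Real.log n := by
      have hne := smallBall_pos.ne'
      rw [hq]; field_simp; norm_num
    rwa [h2] at h1
  -- Only m - 1 steps are taken from the initial 0; the missing one costs q ≤ 1/2 in the exponent,
  -- hence a factor exp(1/2) ≤ 2.
  have h3 : -(q * ((m : ℝ) - 1)) ≤ 1 / 2 - Real.log n := by linarith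
  calc Real.exp (-(q * ((m : ℝ) - 1))) ≤ Real.exp (1 / 2 - Real.log n) := Real.exp_le_exp.2 h3
    _ = Real.exp (1 / 2) / n := by rw [Real.exp_sub, Real.exp_log hn']
    _ ≤ 2 / n := by
      gcongr
      have h4 : Real.exp (1 / 2) ^ 2 = Real.exp 1 := by rw [← Real.exp_nat_mul]; norm_num
      have h5 := Real.exp_one_lt_d9
      nlinarith [Real.exp_pos (1 / 2)]

theorem lastIterate_bound_of_large {Ω : Type*} [MeasurableSpace Ω] {μ : Measure Ω}
    [IsProbabilityMeasure μ] {ε : ℕ → Ω → State d} (hε : ∀ i ≤ n, Measurable (ε i))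
    (hind : iIndepFun (fun i : Fin (n + 1) => ε i) μ)
    (hlaw : ∀ i ≤ n, μ.map (ε i) = stdGaussian (State d)) {Θ' K : Mat d}
    (h : IsLyapunovStable Θ' K ρ) {W : ℝ} (hW : ‖Θ'‖ ≤ W) (hd : 0 < d) (hn : 0 < n)
    (hR : R = effRadius K ρ) (hδ : 0 < δ) (hδ1 : δ < 1) {m : ℕ} (hm : 1 ≤ m)
    (hmn : 512 / smallBall ^ 2 * (4 * R) ^ 2 * Real.exp (8 * ρ * R) * Real.log n ≤ m)
    (hL : L = Real.log (2 * R * n / δ + 1))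
    (hbig : largeSample * Real.exp (8 * ρ * R) * d ^ 2 * R ^ 2 * L ^ 2 / (1 - ρ) ^ 2 ≤ n) :
    ∃ bad : Set Ω, μ bad ≤ ENNReal.ofReal δ ∧ ∀ ω ∉ bad,
      ‖lastIterate relu W (fun _ => ((16 * R) ^ 2)⁻¹ * Real.exp (-(4 * ρ * R))) n
        (trajectory (glm relu Θ') (fun i => ε i ω)) m - Θ'‖ ^ 2 ≤
      errorConst * max (W ^ 2) 1 * Real.exp (8 * ρ * R) * ((d : ℝ) ^ 2 / n) * R ^ 2 * L ^ 2 := by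
  have hρ0 := h.rho_nonneg
  have hρ1 := h.rho_lt_one
  have h1ρ : 0 < 1 - ρ := by linarith
  have hn' : (0 : ℝ) < n := by exact_mod_cast hn
  have hn1 : (1 : ℝ) ≤ n := by exact_mod_cast hn
  have hd1 : (1 : ℝ) ≤ d := by exact_mod_cast hd
  have hdR : (d : ℝ) ≤ R := by
    rw [hR, effRadius, le_div_iff₀ h1ρ]
    have h1 : (d : ℝ) * (1 - ρ) ≤ d := mul_le_of_le_one_right (by linarith) (by linarith)
    exact h1.trans (card_le_trace h)
  have hR1 : 1 ≤ R := hd1.trans hdR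
  have hκ := pow_pos smallBall_pos 2
  have hκ1 : smallBall ^ 2 ≤ 1 := pow_le_one₀ smallBall_pos.le smallBall_le_one
  obtain ⟨hL1, -⟩ := logFactor_bounds hd1 hdR hn1 hδ hδ1 hL
  obtain ⟨hlarge, hΛ⟩ := log_card_le_of_large hd1 hdR hn1 hδ hδ1 hρ0 hρ1 hL hbig
  obtain ⟨hℓ0, hℓ, hℓ4⟩ := log_card_entries_le hd1 hdR hn1 hδ hδ1 hL
  set ℓ := Real.log (8 * d ^ 2 / δ) with hℓdef
  have hMpos : 0 < netSize d R ρ :=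
    Nat.ceil_pos.2 (zero_lt_one.trans_le (one_le_netSize_arg hd1 hR1 hρ0))
  -- This balances the two terms of the noise bound: since ∑ x_k² ≤ 3nR, they become 2ℓ and ℓ.
  set l := √(ℓ / (n * R)) with hl
  have hl2 : l ^ 2 = ℓ / (n * R) := Real.sq_sqrt (by positivity)
  have hbadA := energy_deviation hd hε hind hlaw h (p := δ / 4) (by positivity)
  obtain ⟨badB, hbadB, hB⟩ := noise_event hd hε hind hlaw Θ' l hδ
  obtain ⟨badC, hbadC, hC⟩ := curvature_event hd hε hind hlaw Θ' hMpos hδ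
  rw [← hR] at hbadA
  refine ⟨_ ∪ badB ∪ badC, ((measure_union_le _ _).trans (add_le_add ((measure_union_le _ _).trans
    (add_le_add hbadA hbadB)) hbadC)).trans ?_, fun ω hω => ?_⟩
  · rw [← ENNReal.ofReal_add (by positivity) (by positivity),
      ← ENNReal.ofReal_add (by positivity) (by positivity)]
    exact ENNReal.ofReal_le_ofReal (by linarith)
  rw [Set.mem_union, Set.mem_union, not_or, not_or] at hω
  obtain ⟨⟨hωA, hωB⟩, hωC⟩ := hω
  have hA := not_not.1 hωA
  have hB := hB ω hωB
  have hC := hC ω hωC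
  set e : ℕ → State d := fun i => ε i ω with he
  set x := trajectory (glm relu Θ') e with hx
  have hA3 : ∑ i ∈ Finset.Icc 1 n, energy K (x i) ≤ 3 * (n * R) := by
    refine hA.trans ?_
    have h1 : 12 * R * Real.log (1 / (δ / 4)) / (1 - ρ) ≤ 3 / 4 * (n * R) := by
      rw [div_le_iff₀ h1ρ]
      have h2 : 12 * R * Real.log (1 / (δ / 4)) ≤ 12 * R * (3 * L) := by gcongr
      have h3 := mul_le_mul_of_nonneg_left hlarge (by linarith : 0 ≤ 3 / 4 * R)
      have e1 : 12 * R * (3 * L) = 3 / 4 * R * (48 * L) := by ring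
      have e2 : 3 / 4 * R * (n * (1 - ρ)) = 3 / 4 * (n * R) * (1 - ρ) := by ring
      rw [e1] at h2
      rw [e2] at h3
      exact h2.trans h3
    linarith
  have hS : ∑ i ∈ Finset.Icc 1 n, ‖x i‖ ^ 2 ≤ 3 * (n * R) :=
    (Finset.sum_le_sum fun i _ => norm_sq_le_energy h (x i)).trans hA3
  set α := smallBall ^ 2 / 16 * Real.exp (-(4 * ρ * R)) with hα
  set η := ((16 * R) ^ 2)⁻¹ * Real.exp (-(4 * ρ * R)) with hη
  have hα0 : 0 < α := by positivity
  have hη0 : 0 < η := by positivity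
  have hE4 : Real.exp (-(4 * ρ * R)) ≤ 1 := Real.exp_le_one_iff.2 (by
    have : 0 ≤ ρ * R := by positivity
    linarith)
  have hηR : η * (3 * R) ≤ 1 / 2 := by
    have h1 : η ≤ ((16 * R) ^ 2)⁻¹ := mul_le_of_le_one_right (by positivity) hE4
    calc η * (3 * R) ≤ ((16 * R) ^ 2)⁻¹ * (3 * R) := by gcongr
      _ ≤ 1 / 2 := by
        rw [inv_mul_le_iff₀ (by positivity)]
        have h2 : R ≤ R ^ 2 := le_self_pow₀ hR1 two_ne_zero
        have e : (16 * R) ^ 2 * (1 / 2) = 128 * R ^ 2 := by ring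
        rw [e]
        linarith
  have hα1 : α ≤ 1 := by
    have h1 : α ≤ smallBall ^ 2 / 16 := mul_le_of_le_one_right (by positivity) hE4
    linarith
  have hη1 : η ≤ 1 := by
    have : η ≤ η * (3 * R) := le_mul_of_one_le_right hη0.le (by linarith)
    linarith
  have hηα : η * α ≤ 1 := mul_le_one₀ hη1 hα0.le hα1
  have hcurv := curvature_of_events h hd1 hR1 hn hA3 hΛ hC
  have hS' : 1 / (n : ℝ) * ∑ i ∈ Finset.Icc 1 n, ‖x i‖ ^ 2 ≤ 3 * R := by
    rw [div_mul_eq_mul_div, one_mul, div_le_iff₀ hn']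
    linarith
  have hiter := iterate_error_le hW hη0 hα0 hηα hS' hηR hcurv (m - 1)
  have hexp := contraction_factor_le hR1 hρ0 hm hn hmn
  have hN : ‖noiseGrad n x Θ'‖ ^ 2 ≤ d ^ 2 * (54 * L * R) / n := by
    refine noiseGrad_trajectory_sq_le hn fun j k => ?_
    have h1 := hB j k
    set Z := ∑ i ∈ Finset.Icc 1 n, e i j * x i k with hZ
    replace h1 : |l * Z| ≤ 2 / 3 * l ^ 2 * ∑ i ∈ Finset.Icc 1 n, x i k ^ 2 + ℓ := h1
    have h2 : ∑ i ∈ Finset.Icc 1 n, x i k ^ 2 ≤ 3 * (n * R) := by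
      refine le_trans (Finset.sum_le_sum fun i _ => ?_) hS
      rw [← sq_abs, ← Real.norm_eq_abs]
      exact pow_le_pow_left₀ (norm_nonneg _) (PiLp.norm_apply_le (x i) k) 2
    have h3 : |l * Z| ≤ 3 * ℓ := by
      refine h1.trans ?_
      have h4 : 2 / 3 * l ^ 2 * ∑ i ∈ Finset.Icc 1 n, x i k ^ 2 ≤ 2 / 3 * l ^ 2 * (3 * (n * R)) := by
        gcongr
      have h5 : 2 / 3 * l ^ 2 * (3 * (n * R)) = 2 * ℓ := by
        rw [hl2]; field_simp
      linarith
    have h6 : (l * Z) ^ 2 ≤ (3 * ℓ) ^ 2 := by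
      rw [← sq_abs]; exact pow_le_pow_left₀ (abs_nonneg _) h3 2
    rw [mul_pow, hl2, div_mul_eq_mul_div, div_le_iff₀ (by positivity)] at h6
    have h7 : ℓ * Z ^ 2 ≤ ℓ * (9 * ℓ * (n * R)) := by linarith
    have h8 := le_of_mul_le_mul_left h7 hℓ0
    refine h8.trans ?_
    calc 9 * ℓ * (n * R) ≤ 9 * (6 * L) * (n * R) := by gcongr
      _ = n * (54 * L * R) := by ring
  refine hiter.trans ?_
  set E := Real.exp (8 * ρ * R) with hE
  have hE1 : 1 ≤ E := Real.one_le_exp (by positivity)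
  have hα2 : 8 / α ^ 2 = 2048 / smallBall ^ 4 * E := by
    have h1 : Real.exp (-(4 * ρ * R)) ^ 2 = E⁻¹ := by
      rw [← Real.exp_nat_mul, hE, ← Real.exp_neg]; congr 1; push_cast; ring
    rw [hα, mul_pow, h1]
    have : smallBall ≠ 0 := smallBall_pos.ne'
    field_simp
    norm_num
  set D : ℝ := E * ((d : ℝ) ^ 2 / n) * R ^ 2 * L ^ 2 with hD
  have hκ4 : 0 < smallBall ^ 4 := pow_pos smallBall_pos 4
  have hT1 : Real.exp (-(η * α / 2 * (m - 1 : ℕ))) * W ^ 2 ≤ 2 * max (W ^ 2) 1 * D := by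
    have h1 : (1 : ℝ) / n ≤ D := by
      have hd2 : (1 : ℝ) ≤ (d : ℝ) ^ 2 := one_le_pow₀ hd1
      have hR2 : 1 ≤ R ^ 2 := one_le_pow₀ hR1
      have hL2 : 1 ≤ L ^ 2 := one_le_pow₀ hL1
      calc (1 : ℝ) / n = 1 * (1 / n) * 1 * 1 := by ring
        _ ≤ D := by rw [hD]; gcongr
    calc Real.exp (-(η * α / 2 * (m - 1 : ℕ))) * W ^ 2 ≤ 2 / n * max (W ^ 2) 1 := by
          gcongr
          exact le_max_left _ _
      _ = 2 * max (W ^ 2) 1 * (1 / n) := by ring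
      _ ≤ _ := by gcongr
  have hT2 : 8 / α ^ 2 * ‖noiseGrad n x Θ'‖ ^ 2 ≤ 110592 / smallBall ^ 4 * max (W ^ 2) 1 * D := by
    have hLL : L ≤ L ^ 2 := le_self_pow₀ hL1 two_ne_zero
    have hRR : R ≤ R ^ 2 := le_self_pow₀ hR1 two_ne_zero
    have hmax : 1 ≤ max (W ^ 2) 1 := le_max_right _ _
    calc 8 / α ^ 2 * ‖noiseGrad n x Θ'‖ ^ 2
        ≤ 2048 / smallBall ^ 4 * E * (d ^ 2 * (54 * L * R) / n) := by rw [hα2]; gcongr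
      _ = 110592 / smallBall ^ 4 * 1 * (E * ((d : ℝ) ^ 2 / n) * R * L) := by ring
      _ ≤ 110592 / smallBall ^ 4 * max (W ^ 2) 1 * (E * ((d : ℝ) ^ 2 / n) * R ^ 2 * L ^ 2) := by
        gcongr
  calc _ ≤ 2 * max (W ^ 2) 1 * D + 110592 / smallBall ^ 4 * max (W ^ 2) 1 * D := add_le_add hT1 hT2
    _ = _ := by rw [errorConst, hD]; ring

end LargeSample

/-- The supremum includes p = 2 and a coordinate direction, where isotropy gives exactly 2^(-1/2).
Thus τ can absorb absolute constants. -/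
lemma half_le_varianceProxy {d : ℕ} (hd : 0 < d) {Ω : Type*} [MeasurableSpace Ω] {μ : Measure Ω}
    {n : ℕ} {ε : ℕ → Ω → State d} {τ : ℝ} (h : IsIsotropicNoise μ n ε τ) : 1 / 2 ≤ τ := by
  obtain ⟨hτ0, -, -, hsup⟩ := h.subgaussian 0 (Nat.zero_le n)
  set j : Fin d := ⟨0, hd⟩
  set θ : State d := EuclideanSpace.single j 1 with hθdef
  have hθ : ‖θ‖ = 1 := by simp [hθdef]
  have hsq : ∫ ω, ε 0 ω j * ε 0 ω j ∂μ = 1 := by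
    rw [h.isotropic 0 (Nat.zero_le n) j j, Matrix.one_apply_eq]
  -- A nonintegrable function would have integral 0 by convention, whereas this one has integral 1.
  have hint : Integrable (fun ω => ε 0 ω j * ε 0 ω j) μ := by
    by_contra hcon
    rw [integral_undef hcon] at hsq
    exact zero_ne_one hsq
  have hnorm : eLpNorm (fun ω => inner ℝ (ε 0 ω) θ) (ENNReal.ofReal 2) μ = 1 := by
    have e1 : (fun ω => inner ℝ (ε 0 ω) θ) = fun ω => ε 0 ω j := by
      funext ω
      rw [hθdef, EuclideanSpace.inner_single_right]
      simp
    rw [e1, eLpNorm_eq_lintegral_rpow_enorm_toReal (by simp) (by simp),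
      ENNReal.toReal_ofReal (by norm_num)]
    have e2 : ∫⁻ ω, ‖ε 0 ω j‖ₑ ^ (2 : ℝ) ∂μ = 1 := by
      rw [← ENNReal.ofReal_one, ← hsq, ofReal_integral_eq_lintegral_ofReal hint
        (Filter.Eventually.of_forall fun ω => mul_self_nonneg _)]
      refine lintegral_congr fun ω => ?_
      rw [← ofReal_norm, ENNReal.ofReal_rpow_of_nonneg (norm_nonneg _) (by norm_num)]
      congr 1
      rw [Real.norm_eq_abs, Real.rpow_two, sq_abs, sq]
    rw [e2, ENNReal.one_rpow]
  have hle : ENNReal.ofReal ((2 : ℝ) ^ (-(1 / 2) : ℝ)) * 1 ≤ ENNReal.ofReal τ := by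
    rw [← hsup, ← hnorm]
    exact le_iSup₂_of_le θ hθ (le_iSup₂_of_le (2 : ℝ) one_le_two le_rfl)
  rw [mul_one, ENNReal.ofReal_le_ofReal_iff hτ0] at hle
  refine le_trans ?_ hle
  calc (1 : ℝ) / 2 = (2 : ℝ) ^ (-1 : ℝ) := by rw [Real.rpow_neg_one]; norm_num
    _ ≤ _ := Real.rpow_le_rpow_of_exponent_le one_le_two (by norm_num)

end GLDS

/-! ### Large and small samples combined -/

theorem theorem3 :
    ∃ c c₀ c₁ : ℝ, 0 < c ∧ 0 < c₀ ∧ 0 < c₁ ∧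
      ∀ {Ω : Type*} [MeasurableSpace Ω] (μ : Measure Ω) [IsProbabilityMeasure μ]
        (d n m : ℕ) (Θstar K : GLDS.Mat d) (ρ W τ δ R : ℝ) (ε : ℕ → Ω → GLDS.State d),
        GLDS.IsIsotropicNoise μ n ε τ →
        (∀ i ≤ n, HasLaw (ε i) (stdGaussian (GLDS.State d)) μ) →
        GLDS.IsLyapunovStable Θstar K ρ →
        ‖Θstar‖ ≤ W →
        R = GLDS.effRadius K ρ →
        0 < δ →
        c * (τ ^ 4 * (d : ℝ) ^ 3 / (1 - ρ)) * Real.log (R / δ + 1) ≤ (n : ℝ) →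
        1 ≤ m →
        c₀ * (4 * R) ^ 2 * Real.exp (8 * ρ * R) * Real.log n ≤ (m : ℝ) →
        ENNReal.ofReal (1 - δ) ≤
          μ {ω | ‖GLDS.lastIterate GLDS.relu W
                    (fun _ => ((16 * R) ^ 2)⁻¹ * Real.exp (-(4 * ρ * R))) n
                    (GLDS.trajectory (GLDS.glm GLDS.relu Θstar) (fun i => ε i ω)) m
                  - Θstar‖ ^ 2
                ≤ (c₁ * τ * max (W ^ 2) 1 / (1 - ρ) ^ 2 * Real.exp (8 * ρ * R)) *
                    ((d : ℝ) ^ 2 / n) * R ^ 2 *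
                    Real.log (2 * R * n / δ + 1) ^ 2} := by
  have hκ := GLDS.smallBall_pos
  have hec : 0 < GLDS.errorConst := by unfold GLDS.errorConst; positivity
  have hls : 0 < GLDS.largeSample := by linarith [GLDS.largeSample_ge]
  -- The third constant is twice `errorConst + 4 * largeSample` because τ ≥ 1/2: one summand serves
  -- large samples, the other the trivial bound for small ones.
  refine ⟨1, 512 / GLDS.smallBall ^ 2, 2 * GLDS.errorConst + 8 * GLDS.largeSample, one_pos,
    by positivity, by positivity, ?_⟩
  intro Ω _ μ _ d n m Θstar K ρ W τ δ R ε hε hlaw hK hW hR hδ hcn hm hmn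
  rcases le_or_gt 1 δ with hδ1 | hδ1
  · rw [ENNReal.ofReal_of_nonpos (by linarith)]
    exact zero_le
  rcases Nat.eq_zero_or_pos d with rfl | hd
  · have huniv : ∀ (P : Ω → Prop), (∀ ω, P ω) → ENNReal.ofReal (1 - δ) ≤ μ {ω | P ω} := by
      intro P hP
      have : {ω | P ω} = Set.univ := Set.eq_univ_of_forall hP
      rw [this, measure_univ]
      exact ENNReal.ofReal_le_one.2 (by linarith)
    refine huniv _ fun ω => ?_
    rw [GLDS.frobenius_norm_sq]
    simp
  have hρ0 := hK.rho_nonneg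
  have hρ1 := hK.rho_lt_one
  have h1ρ : 0 < 1 - ρ := by linarith
  have hd' : (0 : ℝ) < d := by exact_mod_cast hd
  have hRpos : 0 < R := by
    rw [hR, GLDS.effRadius]
    exact div_pos (hd'.trans_le (GLDS.card_le_trace hK)) h1ρ
  have hτ := GLDS.half_le_varianceProxy hd hε
  have hτ0 : 0 < τ := by linarith
  -- The sample size condition forces n > 0, its left side being positive.
  have hn' : (0 : ℝ) < n := by
    refine lt_of_lt_of_le ?_ hcn
    have : 0 < Real.log (R / δ + 1) := Real.log_pos (by have := div_pos hRpos hδ; linarith)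
    positivity
  have hn : 0 < n := by exact_mod_cast hn'
  set L := Real.log (2 * R * n / δ + 1) with hL
  set E := Real.exp (8 * ρ * R) with hE
  have hEpos : 0 < E := Real.exp_pos _
  set Q := E * (d : ℝ) ^ 2 * R ^ 2 * L ^ 2 / (1 - ρ) ^ 2 with hQ
  have hQ0 : 0 ≤ Q := by positivity
  have hmax1 : 1 ≤ max (W ^ 2) 1 := le_max_right _ _
  have hrhs : ((2 * GLDS.errorConst + 8 * GLDS.largeSample) * τ * max (W ^ 2) 1 / (1 - ρ) ^ 2 * E) *
      ((d : ℝ) ^ 2 / n) * R ^ 2 * L ^ 2 =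
      (2 * GLDS.errorConst + 8 * GLDS.largeSample) * τ * (max (W ^ 2) 1 * (Q / n)) := by
    rw [hQ]; field_simp
  have hcoef : GLDS.errorConst + 4 * GLDS.largeSample ≤
      (2 * GLDS.errorConst + 8 * GLDS.largeSample) * τ := by nlinarith
  have hlower : (GLDS.errorConst + 4 * GLDS.largeSample) * (max (W ^ 2) 1 * (Q / n)) ≤
      (2 * GLDS.errorConst + 8 * GLDS.largeSample) * τ * (max (W ^ 2) 1 * (Q / n)) := by gcongr
  rw [hrhs]
  rcases le_or_gt (GLDS.largeSample * Q) n with hbig | hsmall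
  · have hbig' : GLDS.largeSample * E * d ^ 2 * R ^ 2 * L ^ 2 / (1 - ρ) ^ 2 ≤ n := by
      refine le_trans (le_of_eq ?_) hbig
      rw [hQ]; ring
    obtain ⟨bad, hbad, hgood⟩ := GLDS.lastIterate_bound_of_large hε.measurable hε.indep
      (fun i hi => (hlaw i hi).map_eq) hK hW hd hn hR hδ hδ1 hm hmn hL hbig'
    have hsub : badᶜ ⊆ {ω | ‖GLDS.lastIterate GLDS.relu W
          (fun _ => ((16 * R) ^ 2)⁻¹ * Real.exp (-(4 * ρ * R))) n
          (GLDS.trajectory (GLDS.glm GLDS.relu Θstar) (fun i => ε i ω)) m - Θstar‖ ^ 2 ≤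
          (2 * GLDS.errorConst + 8 * GLDS.largeSample) * τ * (max (W ^ 2) 1 * (Q / n))} := by
      intro ω hω
      refine (hgood ω hω).trans (le_trans ?_ hlower)
      have hQ1 : E * (d : ℝ) ^ 2 * R ^ 2 * L ^ 2 ≤ Q := by
        rw [hQ, le_div_iff₀ (by positivity)]
        refine mul_le_of_le_one_right (by positivity) ?_
        exact pow_le_one₀ h1ρ.le (by linarith)
      calc GLDS.errorConst * max (W ^ 2) 1 * E * ((d : ℝ) ^ 2 / n) * R ^ 2 * L ^ 2
          = GLDS.errorConst * (max (W ^ 2) 1 * (E * (d : ℝ) ^ 2 * R ^ 2 * L ^ 2 / n)) := by ring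
        _ ≤ (GLDS.errorConst + 4 * GLDS.largeSample) * (max (W ^ 2) 1 * (Q / n)) := by
          gcongr
          linarith
    refine le_trans ?_ (measure_mono hsub)
    have h1 : (1 : ENNReal) ≤ μ bad + μ badᶜ := by
      rw [← measure_univ (μ := μ), ← Set.union_compl_self bad]
      exact measure_union_le _ _
    rw [ENNReal.ofReal_sub 1 hδ.le, ENNReal.ofReal_one, tsub_le_iff_left]
    exact h1.trans (by gcongr)
  -- Here n < `largeSample`·Q, so both matrices lying in the ball of radius W is enough: 4W² is
  -- already below the bound.
  · have huniv : {ω | ‖GLDS.lastIterate GLDS.relu W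
          (fun _ => ((16 * R) ^ 2)⁻¹ * Real.exp (-(4 * ρ * R))) n
          (GLDS.trajectory (GLDS.glm GLDS.relu Θstar) (fun i => ε i ω)) m - Θstar‖ ^ 2 ≤
          (2 * GLDS.errorConst + 8 * GLDS.largeSample) * τ * (max (W ^ 2) 1 * (Q / n))} =
        Set.univ := by
      refine Set.eq_univ_of_forall fun ω => ?_
      have h1 := GLDS.norm_lastIterate_le (n := n)
        (x := GLDS.trajectory (GLDS.glm GLDS.relu Θstar) (fun i => ε i ω)) hW
        (fun _ => ((16 * R) ^ 2)⁻¹ * Real.exp (-(4 * ρ * R))) m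
      have h2 : 1 ≤ GLDS.largeSample * (Q / n) := by
        rw [← mul_div_assoc, le_div_iff₀ hn', one_mul]
        exact hsmall.le
      have h3 := GLDS.norm_sub_sq_le_two (GLDS.lastIterate GLDS.relu W
        (fun _ => ((16 * R) ^ 2)⁻¹ * Real.exp (-(4 * ρ * R))) n
        (GLDS.trajectory (GLDS.glm GLDS.relu Θstar) (fun i => ε i ω)) m) Θstar
      have h4 := pow_le_pow_left₀ (norm_nonneg _) h1 2
      have h5 := pow_le_pow_left₀ (norm_nonneg _) hW 2
      have h6 : W ^ 2 ≤ max (W ^ 2) 1 := le_max_left _ _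
      have h7 : max (W ^ 2) 1 * 1 ≤ max (W ^ 2) 1 * (GLDS.largeSample * (Q / n)) := by gcongr
      have h8 : 0 ≤ GLDS.errorConst * (max (W ^ 2) 1 * (Q / n)) := by positivity
      refine le_trans ?_ hlower
      linarith
    rw [huniv, measure_univ]
    exact ENNReal.ofReal_le_one.2 (by linarith)
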